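/- A \emph{colored cube} is a unit cube whose six faces are colored with six given colors, one color per face and each color appearing exactly once. The \emph{frame} of an $n\times n\times n$ cube consists of the unit cubes lying on its edges (corners included). A collection of colored cubes (repetitions allowed) is said to \emph{build the frame} if distinct members of it can be placed, after suitable rotations, in all positions of the frame so that each of the six faces of the $n\times n\times n$ cube shows a single color, the six faces showing six different colors. Let $\mathrm{fr}(n)$ be the smallest $m$ such that every collection of $m$ colored cubes builds the frame of an $n\times n\times n$ cube. Theorem B. Let $n\ge 4$. The frame of an $n\times n\times n$ cube consists of exactly $12n-16$ unit cubes, and any collection of $12n-16$ colored cubes can be arranged into the frame of an $n\times n\times n$ cube with monochromatic faces. Consequently $\mathrm{fr}(n)=12n-16$. -/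

import Mathlib

/-- The six faces of an axis-parallel cube: `(i, s)` is the face whose outward unit normal is
`s • eᵢ`. -/
abbrev CubeFace : Type := Fin 3 × ℤˣ

/-- A colored cube (in some initial position): each face gets exactly one of the six colors
`0, …, 5`, and every color appears. -/
abbrev ColoredCube : Type := CubeFace ≃ Fin 6

/-- `g` is the permutation of the faces induced by a rotation of the cube, i.e. by a
signed permutation matrix `eᵢ ↦ ε i • e_(σ i)` of determinant `sign σ * ∏ i, ε i = 1`. -/
def IsRotation (g : Equiv.Perm CubeFace) : Prop :=
  ∃ (σ : Equiv.Perm (Fin 3)) (ε : Fin 3 → ℤˣ),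
    Equiv.Perm.sign σ * ∏ i, ε i = 1 ∧ ∀ i s, g (i, s) = (σ i, ε i * s)

/-- The `n³` positions of unit cubes in an `n × n × n` cube. -/
abbrev CubePos (n : ℕ) : Type := Fin 3 → Fin n

/-- The unit cube at position `p` has its face in direction `f` on the
face in direction `f` of the `n × n × n` cube. -/
def OnFace {n : ℕ} (p : CubePos n) (f : CubeFace) : Prop :=
  (f.2 = 1 ∧ (p f.1 : ℕ) + 1 = n) ∨ (f.2 = -1 ∧ (p f.1 : ℕ) = 0)

/-- The positions of the frame (edges and corners) of the `n × n × n` cube: those lying on at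
least two of its faces. -/
def FramePos (n : ℕ) : Type := {p : CubePos n // ∃ f g : CubeFace, f ≠ g ∧ OnFace p f ∧ OnFace p g}

/-- The frame of an `n × n × n` cube can be built from a subset of the collection `cubes`:
every position of the frame is filled by its own member of the collection, in some rotated
position, such that each face of the big cube shows a single color, the six faces being colored
like those of a colored cube `model`. -/
def CanBuildFrame (n : ℕ) {ι : Type*} (cubes : ι → ColoredCube) : Prop :=
  ∃ (model : ColoredCube) (place : FramePos n → ι) (rot : FramePos n → Equiv.Perm CubeFace),
    Function.Injective place ∧ (∀ p, IsRotation (rot p)) ∧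
      ∀ (p : FramePos n) (f : CubeFace), OnFace p.1 f →
        cubes (place p) ((rot p).symm f) = model f

/-- The frame function: the smallest size `m` such that a frame of an `n × n × n` cube can be
built from every collection of `m` colored cubes (repetitions allowed). -/
noncomputable def fr (n : ℕ) : ℕ :=
  sInf {m : ℕ | ∀ cubes : Fin m → ColoredCube, CanBuildFrame n cubes}

/-! The frame of side `N + 2` has 8 corners and 12 edges with `N` inner positions each. A cube can
fill an edge position unless the two colors required there are opposite on it, and a corner if it
shows the required cyclic triple of colors. For a fixed model `M`, Hall's theorem
(`canBuildFrame_of_hall`) asks for three things: Hall's condition for the corners alone; no two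
colors meeting on an edge of `M` are opposite in more than `11 * N` cubes; no class (cubes up to
rotation and reflection) in which such a pair is opposite has more than `9 * N` members. The reason
is that cubes excluded by two different edges have two known opposite pairs, hence lie in one class,
and they are then excluded by at most three edges.

The model is chosen in `canBuildFrame_of_card`. If some class is larger than `9 * N`, take the
commoner of its two mirror forms. If some pair is opposite in more than `11 * N` cubes, take the
commoner form of the largest class with that pair. Otherwise the counting conditions hold for every
model, and it remains to find one whose corners satisfy Hall's condition; `exists_cornerHall` does
this for any 32 cubes.

That lemma rests on a finite search. Let `M` be a most frequent cube and `T` a set of corners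
violating Hall's condition for it. After rotating and renaming colors, `M` is standard and `T` is
one of 22 sets, and few cubes fit corners in `T`. The search shows that multiplicities with these
properties, for which no mask is fillable, sum to at most 31. For each mask it keeps a graph on the
eight corners: a cube of another type fitting two corners is an edge that can fill one of its ends.
A tree then lacks one corner, which may be chosen freely, and a component with a cycle lacks none.
So a mask is fillable once it has as many copies of its own as there are trees left. -/

/-! ### Weighted corner types

A colored cube is encoded by the bit mask of its eight oriented corners, the bits being the codes of
cyclically ordered triples of colors. Two cubes can be rotated into each other iff their masks agree. -/

/-- The mask of the standard coloring. -/
def stdMask : ℕ := 595204733956977131520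

/-- The masks of the 29 other colored cubes up to rotation. -/
def otherMasks : List ℕ := [
  304952241576799764480, 1189896057552394813440, 332331875520052592640, 627265859717045452800,
  1185782019297083719680, 40584626248227059341074158846976, 673439381375867562771433392128,
  81763463715015946553519211807232, 2555108241085105952202399680512,
  43100120407764413588723371868672, 81169252495863890425788569748480,
  673439381961830910282195665920, 40584626247941706765086375348224,
  5575186299632675592425148502114444190482688, 174224571864154318593362492418383039965184,
  174224571863560107374514226603510202499328, 5575186299673220604591233199492165676311552,
  2555108242274839880148207141376, 81763463714757978115065223088128,
  174224571864154318594547117012551670464768, 5575186299632675592424595032238244399949824,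
  5575186299635191086584390926881486952595712, 174224571944650131707863708576495114920448,
  81169252496491003163091936543232, 43100120408940967732357691376640,
  5575186299673220604591564950403311688777984, 174224571863560107375685531801778897560576,
  174224571944650131708150205066786120466688, 5575186299635191086584976331782641814610432]

/-- The masks of the 30 colored cubes up to rotation. -/
def masks : List ℕ := stdMask :: otherMasks

/-- Sizes and masks of representatives of the nonempty sets of corners of the standard cube up to
rotation. -/
def cornerSets : List (ℕ × ℕ) := [
  (1, 65536), (2, 4295032832), (2, 4429185024), (3, 4429250560), (4, 4437639168),
  (3, 4611686022856572928), (4, 4611686022856638464), (2, 4611686018435776512),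
  (3, 4611686018435842048), (4, 4611686022730809344), (4, 4611686018570059776),
  (4, 4611686022864961536), (5, 4611686022865027072), (4, 4620693217824735232),
  (5, 4620693217824800768), (6, 4620693222119768064), (4, 297237575414906880),
  (5, 297237579709874176), (6, 297237579844091904), (6, 4908923598271414272),
  (7, 4908923598271479808), (8, 595204733956977131520)]

/-- Codes are below 144 because the least of three distinct numbers below 6 is at most 3 and is the
leading digit. -/
def bits (m : ℕ) : Finset ℕ := (Finset.range 144).filter fun v => m.testBit v

/-- The corners in `m` can be filled by cubes whose masks contain them, if `w k` cubes of mask `k`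
are available. -/
def Fillable (w : ℕ → ℕ) (m : ℕ) : Prop :=
  ∃ f : ℕ → ℕ, (∀ v ∈ bits m, (f v).testBit v) ∧ ∀ k, ((bits m).filter fun v => f v = k).card ≤ w k

/-- The corners in `S` can be filled by cubes of masks other than `m`, using at most `L k` cubes of
mask `k`. -/
def Covered (L : ℕ → ℕ) (m : ℕ) (S : Finset ℕ) : Prop :=
  ∃ f : ℕ → ℕ, (∀ v ∈ S, (f v).testBit v ∧ f v ≠ m) ∧ ∀ k, (S.filter fun v => f v = k).card ≤ L k

def Hits (R : Finset ℕ) (t : ℕ) : Prop := t ≠ 0 → ∃ v ∈ R, t.testBit v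

/-- Every transversal `R` of the sets in `ts` leaves a set of corners of `m` which can be filled by
cubes of other masks. -/
def TreeInv (L : ℕ → ℕ) (m : ℕ) (ts : List ℕ) : Prop :=
  ∀ R : Finset ℕ, (∀ t ∈ ts, Hits R t) → Covered L m (bits m \ R)

/-- The components left deficient after adding `l` cubes which fit the corners in `e`. -/
def addEdge (e l : ℕ) : List ℕ → List ℕ → List ℕ → List ℕ
  | [], [], r => r
  | [], [_], r => r
  | [], [a, b], r => bif Nat.beq l 1 then Nat.lor a b :: r else r
  | [], h, r => h ++ r
  | t :: ts, h, r =>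
    bif Nat.beq (Nat.land t e) 0 then addEdge e l ts h (t :: r) else addEdge e l ts (t :: h) r

def singles (m : ℕ) : List ℕ := ((List.range 144).filter fun v => m.testBit v).map (Nat.pow 2)

theorem land_beq_zero_eq_false {a b : ℕ} :
    Nat.beq (Nat.land a b) 0 = false ↔ ∃ v, a.testBit v ∧ b.testBit v := by
  have h : Nat.land a b = a &&& b := rfl
  rw [h]
  constructor
  · intro h
    by_contra hc
    push Not at hc
    have : a &&& b = 0 := by
      apply Nat.eq_of_testBit_eq
      intro i
      rw [Nat.testBit_and, Nat.zero_testBit]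
      cases ha : a.testBit i
      · rfl
      · simpa using hc i ha
    rw [this] at h
    simp at h
  · rintro ⟨v, ha, hb⟩
    by_contra hc
    rw [Bool.not_eq_false, Nat.beq_eq] at hc
    have := Nat.testBit_and a b v
    rw [hc] at this
    simp [ha, hb] at this

/-- This is the exchange behind the graph picture: `A` consists of the corners taken by the new
cubes. If one cube joins two trees, `R` already hits one of them, and the cube takes its corner in
the other. With two cubes both trees are served. When `e` touches three or more components the new
cubes are simply ignored. -/
theorem addEdge_transversal {e l : ℕ} (hl : 1 ≤ l) (R : Finset ℕ) :
    ∀ (ts h r : List ℕ), (∀ t ∈ h, ∃ v, t.testBit v ∧ e.testBit v) →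
      (∀ t ∈ addEdge e l ts h r, Hits R t) →
      ∃ A : Finset ℕ, A.card ≤ l ∧ (∀ v ∈ A, e.testBit v) ∧
        ∀ t, t ∈ ts ∨ t ∈ h ∨ t ∈ r → Hits (R ∪ A) t := by
  have mono : ∀ (A : Finset ℕ) t, Hits R t → Hits (R ∪ A) t := fun A t h h0 =>
    let ⟨v, hv, hb⟩ := h h0
    ⟨v, Finset.mem_union_left _ hv, hb⟩
  have new : ∀ (A : Finset ℕ) t v, v ∈ A → t.testBit v → Hits (R ∪ A) t := fun A t v hv hb _ =>
    ⟨v, Finset.mem_union_right _ hv, hb⟩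
  intro ts
  induction ts with
  | nil =>
    intro h r hh hR
    match h, hh, hR with
    | [], _, hR =>
      refine ⟨∅, by simp, by simp, fun t ht => mono _ t (hR t ?_)⟩
      simpa [addEdge] using ht
    | [a], hh, hR =>
      obtain ⟨v, hv, he⟩ := hh a (by simp)
      refine ⟨{v}, by simpa using hl, by simpa using he, fun t ht => ?_⟩
      rcases ht with ht | ht | ht
      · simp at ht
      · rw [List.mem_singleton] at ht
        exact new _ t v (by simp) (ht ▸ hv)
      · exact mono _ t (hR t (by simpa [addEdge] using ht))
    | [a, b], hh, hR =>
      obtain ⟨v, hv, he⟩ := hh a (by simp)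
      obtain ⟨u, hu, hf⟩ := hh b (by simp)
      by_cases h1 : l = 1
      · have hR' : ∀ t, t = Nat.lor a b ∨ t ∈ r → Hits R t := by simpa [addEdge, h1] using hR
        have hab : ∀ i, (Nat.lor a b).testBit i = (a.testBit i || b.testBit i) :=
          Nat.testBit_or a b
        obtain ⟨x, hx, hxb⟩ := hR' _ (Or.inl rfl) (by
          intro h0
          have := hab v
          rw [h0, hv, Nat.zero_testBit] at this
          cases this)
        rw [hab, Bool.or_eq_true] at hxb
        rcases hxb with hxb | hxb
        · refine ⟨{u}, by simpa using hl, by simpa using hf, fun t ht => ?_⟩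
          rcases ht with ht | ht | ht
          · simp at ht
          · simp only [List.mem_cons, List.not_mem_nil, or_false] at ht
            rcases ht with rfl | rfl
            · exact mono _ _ fun _ => ⟨x, hx, hxb⟩
            · exact new _ _ u (by simp) hu
          · exact mono _ t (hR' t (Or.inr ht))
        · refine ⟨{v}, by simpa using hl, by simpa using he, fun t ht => ?_⟩
          rcases ht with ht | ht | ht
          · simp at ht
          · simp only [List.mem_cons, List.not_mem_nil, or_false] at ht
            rcases ht with rfl | rfl
            · exact new _ _ v (by simp) hv
            · exact mono _ _ fun _ => ⟨x, hx, hxb⟩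
          · exact mono _ t (hR' t (Or.inr ht))
      · have hb : Nat.beq l 1 = false := by
          rw [← Bool.not_eq_true, Nat.beq_eq]
          exact h1
        refine ⟨{v, u}, (Finset.card_le_two).trans (by omega), ?_, fun t ht => ?_⟩
        · intro i hi
          simp only [Finset.mem_insert, Finset.mem_singleton] at hi
          rcases hi with rfl | rfl <;> assumption
        rcases ht with ht | ht | ht
        · simp at ht
        · simp only [List.mem_cons, List.not_mem_nil, or_false] at ht
          rcases ht with rfl | rfl
          · exact new _ _ v (by simp) hv
          · exact new _ _ u (by simp) hu
        · exact mono _ t (hR t (by simpa [addEdge, hb] using ht))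
    | a :: b :: c :: h, hh, hR =>
      refine ⟨∅, by simp, by simp, fun t ht => mono _ t (hR t ?_)⟩
      simpa [addEdge, or_assoc] using ht
  | cons s ts ih =>
    intro h r hh hR
    cases hs : Nat.beq (Nat.land s e) 0
    · obtain ⟨A, hA, hAe, hA'⟩ := ih (s :: h) r (by
        intro t ht
        rcases List.mem_cons.1 ht with rfl | ht
        · exact land_beq_zero_eq_false.1 hs
        · exact hh t ht) (by rwa [show addEdge e l (s :: ts) h r = _ from by rw [addEdge, hs, cond_false]] at hR)
      refine ⟨A, hA, hAe, fun t ht => hA' t ?_⟩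
      simp only [List.mem_cons] at ht ⊢
      tauto
    · obtain ⟨A, hA, hAe, hA'⟩ := ih h (s :: r) hh (by rwa [show addEdge e l (s :: ts) h r = _ from by rw [addEdge, hs, cond_true]] at hR)
      refine ⟨A, hA, hAe, fun t ht => hA' t ?_⟩
      simp only [List.mem_cons] at ht ⊢
      tauto

theorem TreeInv.mono {L L' : ℕ → ℕ} {m : ℕ} {ts : List ℕ} (h : TreeInv L m ts)
    (hL : ∀ k, L k ≤ L' k) : TreeInv L' m ts := fun R hR =>
  let ⟨f, hf, hc⟩ := h R hR
  ⟨f, hf, fun k => (hc k).trans (hL k)⟩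

theorem treeInv_singles (m : ℕ) : TreeInv (fun _ => 0) m (singles m) := by
  intro R hR
  have hs : bits m \ R = ∅ := by
    rw [Finset.sdiff_eq_empty_iff_subset]
    intro v hv
    simp only [bits, Finset.mem_filter, Finset.mem_range] at hv
    obtain ⟨u, hu, hb⟩ := hR (2 ^ v) (by
      simp only [singles, List.mem_map, List.mem_filter, List.mem_range]
      exact ⟨v, hv, rfl⟩) (by positivity)
    rw [Nat.testBit_two_pow] at hb
    simp only [decide_eq_true_eq] at hb
    exact hb ▸ hu
  rw [hs]
  exact ⟨fun _ => 0, by simp, by simp⟩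

/-- The corners in `A` go to the cubes of mask `k`. Since `L k = 0`, the earlier covering used none
of them, so the new bound `l` is respected. -/
theorem TreeInv.addEdge {L : ℕ → ℕ} {m k l : ℕ} {ts : List ℕ} (h : TreeInv L m ts)
    (hk : L k = 0) (hkm : k ≠ m) (hl : 1 ≤ l) :
    TreeInv (Function.update L k l) m (addEdge (Nat.land m k) l ts [] []) := by
  intro R hR
  obtain ⟨A, hA, hAe, hA'⟩ := addEdge_transversal hl R ts [] [] (by simp) hR
  have hAk : ∀ v ∈ A, k.testBit v := by
    intro v hv
    have h1 := hAe v hv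
    have h2 : (Nat.land m k).testBit v = (m.testBit v && k.testBit v) := Nat.testBit_and m k v
    rw [h2, Bool.and_eq_true] at h1
    exact h1.2
  obtain ⟨f, hf, hc⟩ := h (R ∪ A) fun t ht => hA' t (Or.inl ht)
  have hmem : ∀ v, v ∈ bits m \ R → v ∉ A → v ∈ bits m \ (R ∪ A) := by
    intro v hv hvA
    simp only [Finset.mem_sdiff, Finset.mem_union] at hv ⊢
    tauto
  refine ⟨fun v => if v ∈ A then k else f v, ?_, ?_⟩
  · intro v hv
    by_cases hvA : v ∈ A
    · simpa [hvA] using ⟨hAk v hvA, hkm⟩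
    · simpa [hvA] using hf v (hmem v hv hvA)
  · intro k'
    by_cases hkk : k' = k
    · subst hkk
      rw [Function.update_self]
      refine le_trans (Finset.card_le_card ?_) hA
      intro v hv
      rw [Finset.mem_filter] at hv
      by_contra hvA
      have h0 := hc k'
      rw [hk, Nat.le_zero, Finset.card_eq_zero] at h0
      have : v ∈ (bits m \ (R ∪ A)).filter fun v => f v = k' :=
        Finset.mem_filter.2 ⟨hmem v hv.1 hvA, by simpa [hvA] using hv.2⟩
      simp [h0] at this
    · rw [Function.update_of_ne hkk]
      refine le_trans (Finset.card_le_card ?_) (hc k')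
      intro v hv
      rw [Finset.mem_filter] at hv ⊢
      have hvA : v ∉ A := by
        intro hvA
        have := hv.2
        simp only [hvA, if_true] at this
        exact hkk this.symm
      exact ⟨hmem v hv.1 hvA, by simpa [hvA] using hv.2⟩

/-- Picking one corner from each deficient component gives a transversal. Cubes of mask `m` itself
fill it, and other masks cover the rest. -/
theorem TreeInv.fillable {L w : ℕ → ℕ} {m : ℕ} {ts : List ℕ} (h : TreeInv L m ts)
    (hL : ∀ k, L k ≤ w k) (hm : ts.length ≤ w m) : Fillable w m := by
  have hφ : ∀ t : ℕ, ∃ v, t ≠ 0 → t.testBit v := by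
    intro t
    by_cases ht : t = 0
    · exact ⟨0, fun h => (h ht).elim⟩
    · obtain ⟨v, hv⟩ := Nat.exists_testBit_of_ne_zero ht
      exact ⟨v, fun _ => hv⟩
  choose φ hφ using hφ
  obtain ⟨f, hf, hc⟩ := h (ts.toFinset.image φ) fun t ht h0 =>
    ⟨φ t, Finset.mem_image_of_mem _ (List.mem_toFinset.2 ht), hφ t h0⟩
  set R := ts.toFinset.image φ
  have hR : R.card ≤ w m :=
    (Finset.card_image_le.trans (List.toFinset_card_le ts)).trans hm
  refine ⟨fun v => if v ∈ R then m else f v, ?_, fun k => ?_⟩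
  · intro v hv
    by_cases hvR : v ∈ R
    · simpa [hvR] using (Finset.mem_filter.1 hv).2
    · simpa [hvR] using (hf v (Finset.mem_sdiff.2 ⟨hv, hvR⟩)).1
  · by_cases hk : k = m
    · subst hk
      refine le_trans (Finset.card_le_card ?_) hR
      intro v hv
      rw [Finset.mem_filter] at hv
      by_contra hvR
      exact (hf v (Finset.mem_sdiff.2 ⟨hv.1, hvR⟩)).2 (by simpa [hvR] using hv.2)
    · refine le_trans (Finset.card_le_card ?_) ((hc k).trans (hL k))
      intro v hv
      rw [Finset.mem_filter] at hv ⊢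
      have hvR : v ∉ R := by
        intro hvR
        have := hv.2
        simp only [hvR, if_true] at this
        exact hk this.symm
      exact ⟨Finset.mem_sdiff.2 ⟨hv.1, hvR⟩, by simpa [hvR] using hv.2⟩

/-! ### Branch and bound over multiplicities -/

/-- A mask `mask`, bounds `lo` and `hi` for the number of cubes with this mask, and the deficient
components `trees` left after filling its corners with the cubes known to be available. -/
structure Cell where
  mask : ℕ
  lo : ℕ
  hi : ℕ
  trees : List ℕ

/-- Record that the number of cubes of mask `k` is between `l` and `h`; `none` means that some mask
has become fillable. -/
def assign (k l h : ℕ) : List Cell → Option (List Cell)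
  | [] => some []
  | ⟨m, a, b, ts⟩ :: cs =>
    bif Nat.beq m k then (assign k l h cs).map (⟨m, l, h, ts⟩ :: ·)
    else bif Nat.beq (Nat.land m k) 0 then (assign k l h cs).map (⟨m, a, b, ts⟩ :: ·)
    else
      let ts' := addEdge (Nat.land m k) l ts [] []
      -- Here `b - (b - x)` is the minimum of `b` and `x`. A mask that is not fillable has fewer
      -- cubes than deficient components.
      let b' := Nat.sub b (Nat.sub b (Nat.pred ts'.length))
      bif Nat.ble ts'.length a then none
      else bif Nat.beq b' 0 then assign k l h cs
      else (assign k l h cs).map (⟨m, a, b', ts'⟩ :: ·)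

/-- The sums of the upper bounds over the masks meeting `T`, and over the others. -/
def hiSums (T : ℕ) : List Cell → ℕ → ℕ → ℕ × ℕ
  | [], a, b => (a, b)
  | ⟨m, _, u, _⟩ :: cs, a, b =>
    bif Nat.beq (Nat.land m T) 0 then hiSums T cs a (Nat.add b u)
    else hiSums T cs (Nat.add a u) b

/-- An open mask with the most deficient components, and its upper bound. -/
def pick : List Cell → ℕ → ℕ → ℕ → ℕ × ℕ
  | [], k, x, _ => (k, x)
  | ⟨m, l, u, ts⟩ :: cs, k, x, t =>
    bif Nat.beq l 0 && Nat.ble t ts.length then pick cs m u ts.length else pick cs k x t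

def erase (k : ℕ) : List Cell → List Cell
  | [] => []
  | ⟨m, l, u, ts⟩ :: cs => bif Nat.beq m k then cs else ⟨m, l, u, ts⟩ :: erase k cs

/-- Branch on the number (zero, one, or more) of cubes of a mask, until the upper bounds exclude a
total of 32. -/
def search (T R : ℕ) : ℕ → List Cell → Bool
  | 0, _ => false
  | n + 1, cs =>
    match hiSums T cs 0 0 with
    | (a, b) =>
      bif Nat.ble (Nat.add b (Nat.sub a (Nat.sub a R))) 31 then true
      else match pick cs 0 0 0 with
        | (k, x) =>
          bif Nat.beq x 0 then false
          else
            (bif Nat.beq x 1 then true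
              -- Recording two cubes is enough: two already serve both components that the mask
              -- touches.
              else match assign k 2 x cs with
                | none => true
                | some r => search T R n r) &&
            (match assign k 1 1 cs with
              | none => true
              | some r => search T R n r) &&
            search T R n (erase k cs)

/-- If the masks meeting `T` have total weight at most `t - 1` and the standard one takes `z`, each
other mask meeting `T` has at most `r = t - 1 - z`. The test `a = 0` singles out the masks not yet
assigned. -/
def restrict (T r : ℕ) : List Cell → List Cell
  | [] => []
  | ⟨m, a, b, ts⟩ :: cs =>
    bif Nat.beq a 0 && !(Nat.beq (Nat.land m T) 0) then
      bif Nat.beq r 0 then restrict T r cs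
      else ⟨m, a, Nat.sub b (Nat.sub b r), ts⟩ :: restrict T r cs
    else ⟨m, a, b, ts⟩ :: restrict T r cs

def initial (z : ℕ) : Option (List Cell) :=
  assign stdMask z z (masks.map fun k => ⟨k, 0, z, singles k⟩)

/-- The search over all weights at most `z` with weight `z` at the standard mask. -/
def searchFrom (z : ℕ) : Bool :=
  match initial z with
  | none => true
  | some cs => cornerSets.all fun p =>
    -- A set of at most `z` corners cannot violate Hall's condition, since the standard mask meets
    -- it with weight `z`.
    bif Nat.ble p.1 z then true
    else search p.2 (Nat.pred p.1) 40 (restrict p.2 (Nat.sub (Nat.pred p.1) z) cs)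

-- Only `2 ≤ z ≤ 7` occurs: 32 cubes have 30 possible masks, and a violating set has at most 8
-- corners, hence `z < 8`.
set_option maxRecDepth 100000 in
theorem searchFrom_two : searchFrom 2 = true := by decide +kernel
set_option maxRecDepth 100000 in
theorem searchFrom_three : searchFrom 3 = true := by decide +kernel
set_option maxRecDepth 100000 in
theorem searchFrom_four : searchFrom 4 = true := by decide +kernel
set_option maxRecDepth 100000 in
theorem searchFrom_five : searchFrom 5 = true := by decide +kernel
set_option maxRecDepth 100000 in
theorem searchFrom_six : searchFrom 6 = true := by decide +kernel
set_option maxRecDepth 100000 in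
theorem searchFrom_seven : searchFrom 7 = true := by decide +kernel

/-! ### Soundness of the search -/

structure Cell.Ok (w L : ℕ → ℕ) (c : Cell) : Prop where
  mem : c.mask ∈ masks
  notFillable : ¬Fillable w c.mask
  lo_eq : L c.mask = c.lo
  lo_le : c.lo ≤ w c.mask
  le_hi : w c.mask ≤ c.hi
  inv : TreeInv L c.mask c.trees

/-- The total weight of the masks satisfying `p`. -/
def weight (w : ℕ → ℕ) (p : ℕ → Bool) (cs : List Cell) : ℕ :=
  (cs.map fun c => bif p c.mask then w c.mask else 0).sum

theorem weight_cons (w : ℕ → ℕ) (p : ℕ → Bool) (c : Cell) (cs : List Cell) :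
    weight w p (c :: cs) = (bif p c.mask then w c.mask else 0) + weight w p cs := by
  simp [weight]

theorem natBeq_eq_decide (a b : ℕ) : Nat.beq a b = decide (a = b) := by
  rw [Bool.eq_iff_iff, Nat.beq_eq, decide_eq_true_eq]

theorem natBle_eq_decide (a b : ℕ) : Nat.ble a b = decide (a ≤ b) := by
  rw [Bool.eq_iff_iff, Nat.ble_eq, decide_eq_true_eq]

/-- Here `w` is the true multiplicity and `L` the part of it recorded so far. The outcome `none`
would make some mask fillable, which `Cell.Ok` excludes. Dropped cells have weight zero, so all
weight sums survive. -/
theorem assign_ok {w L : ℕ → ℕ} {k l h : ℕ} (hL : ∀ k, L k ≤ w k) (hk : L k = 0) (hl : 1 ≤ l)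
    (hlw : l ≤ w k) (hwh : w k ≤ h) :
    ∀ cs : List Cell, (∀ c ∈ cs, c.Ok w L) → ∃ r, assign k l h cs = some r ∧
      (∀ c ∈ r, c.Ok w (Function.update L k l)) ∧ ∀ p, weight w p r = weight w p cs := by
  have hL' : ∀ j, L j ≤ Function.update L k l j := by
    intro j
    by_cases hj : j = k
    · subst hj
      rw [hk]
      exact Nat.zero_le _
    · rw [Function.update_of_ne hj]
  have hLw : ∀ j, Function.update L k l j ≤ w j := by
    intro j
    by_cases hj : j = k
    · subst hj
      rwa [Function.update_self]
    · rw [Function.update_of_ne hj]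
      exact hL j
  intro cs
  induction cs with
  | nil => exact fun _ => ⟨[], rfl, by simp, fun _ => rfl⟩
  | cons c cs ih =>
    intro hc
    obtain ⟨r, hr, hr', hw⟩ := ih fun c hc' => hc c (List.mem_cons_of_mem _ hc')
    have c_ok := hc c List.mem_cons_self
    obtain ⟨m, a, b, ts⟩ := c
    obtain ⟨hm, hf, hlo, hlo', hhi, hinv⟩ := c_ok
    simp only at hm hf hlo hlo' hhi hinv
    have keep : ∀ c' : Cell, c'.mask = m → c'.Ok w (Function.update L k l) →
        (∀ c ∈ c' :: r, c.Ok w (Function.update L k l)) ∧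
          ∀ p, weight w p (c' :: r) = weight w p (⟨m, a, b, ts⟩ :: cs) := by
      intro c' hc' hok
      refine ⟨?_, fun p => by rw [weight_cons, weight_cons, hw, hc']⟩
      intro c hc
      rcases List.mem_cons.1 hc with rfl | hc
      · exact hok
      · exact hr' c hc
    rw [assign]
    by_cases hmk : m = k
    · subst hmk
      rw [natBeq_eq_decide, decide_eq_true rfl, cond_true, hr]
      exact ⟨_, rfl, keep _ rfl
        ⟨hm, hf, Function.update_self .., hlw, hwh, hinv.mono hL'⟩⟩
    · rw [natBeq_eq_decide, decide_eq_false hmk, cond_false]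
      have hLm : Function.update L k l m = a := by
        rw [Function.update_of_ne hmk]
        exact hlo
      cases he : Nat.beq (Nat.land m k) 0
      · have hinv' := hinv.addEdge hk (Ne.symm hmk) hl
        have hlt : w m < (addEdge (Nat.land m k) l ts [] []).length := by
          by_contra hcon
          exact hf (hinv'.fillable hLw (not_lt.1 hcon))
        rw [cond_false]
        simp only
        rw [natBle_eq_decide, decide_eq_false (by omega), cond_false]
        set b' := Nat.sub b (Nat.sub b (Nat.pred (addEdge (Nat.land m k) l ts [] []).length))
          with hb'
        have hwb : w m ≤ b' := by
          have : b' = b - (b - ((addEdge (Nat.land m k) l ts [] []).length - 1)) := hb'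
          omega
        by_cases hb0 : b' = 0
        · rw [natBeq_eq_decide, decide_eq_true hb0, cond_true, hr]
          refine ⟨r, rfl, hr', fun p => ?_⟩
          rw [weight_cons, hw]
          have : w m = 0 := by omega
          simp [this]
        · rw [natBeq_eq_decide, decide_eq_false hb0, cond_false, hr]
          exact ⟨_, rfl, keep _ rfl ⟨hm, hf, hLm, hlo', hwb, hinv'⟩⟩
      · rw [cond_true, hr]
        exact ⟨_, rfl, keep _ rfl ⟨hm, hf, hLm, hlo', hhi, hinv.mono hL'⟩⟩

/-- Whether a mask meets `T`. -/
def meets (T m : ℕ) : Bool := !(Nat.beq (Nat.land m T) 0)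

theorem weight_le_hiSums {w L : ℕ → ℕ} (T : ℕ) :
    ∀ (cs : List Cell) (a b : ℕ), (∀ c ∈ cs, c.Ok w L) →
      weight w (meets T) cs + a ≤ (hiSums T cs a b).1 ∧
        weight w (fun m => !(meets T m)) cs + b ≤ (hiSums T cs a b).2 := by
  intro cs
  induction cs with
  | nil => exact fun a b _ => ⟨by simp [weight, hiSums], by simp [weight, hiSums]⟩
  | cons c cs ih =>
    intro a b hc
    have ih' := fun a b => ih a b fun c hc' => hc c (List.mem_cons_of_mem _ hc')
    have hhi := (hc c List.mem_cons_self).le_hi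
    obtain ⟨m, l, u, ts⟩ := c
    simp only at hhi
    rw [hiSums, weight_cons, weight_cons, Nat.add_eq, Nat.add_eq]
    simp only [meets]
    cases Nat.beq (Nat.land m T) 0
    · have := ih' (Nat.add a u) b
      rw [Nat.add_eq] at this
      simp only [cond_false, Bool.not_false, Bool.not_true, cond_true]
      simp only [meets] at this
      omega
    · have := ih' a (Nat.add b u)
      rw [Nat.add_eq] at this
      simp only [cond_false, Bool.not_false, Bool.not_true, cond_true]
      simp only [meets] at this
      omega

theorem weight_add_weight_not (w : ℕ → ℕ) (p : ℕ → Bool) (cs : List Cell) :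
    weight w p cs + weight w (fun m => !(p m)) cs = weight w (fun _ => true) cs := by
  induction cs with
  | nil => rfl
  | cons c cs ih =>
    rw [weight_cons, weight_cons, weight_cons, ← ih]
    cases p c.mask <;> simp <;> ring

theorem pick_spec : ∀ (cs : List Cell) (k x t : ℕ), pick cs k x t = (k, x) ∨
    ∃ c ∈ cs, c.lo = 0 ∧ pick cs k x t = (c.mask, c.hi) := by
  intro cs
  induction cs with
  | nil => exact fun k x t => Or.inl rfl
  | cons c cs ih =>
    intro k x t
    obtain ⟨m, l, u, ts⟩ := c
    rw [pick]
    by_cases h : (Nat.beq l 0 && Nat.ble t ts.length) = true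
    · rw [h, cond_true]
      right
      rw [Bool.and_eq_true, Nat.beq_eq] at h
      rcases ih m u ts.length with h' | ⟨c, hc, hc'⟩
      · exact ⟨_, List.mem_cons_self, h.1, h'⟩
      · exact ⟨c, List.mem_cons_of_mem _ hc, hc'⟩
    · rw [Bool.not_eq_true] at h
      rw [h, cond_false]
      rcases ih k x t with h' | ⟨c, hc, hc'⟩
      · exact Or.inl h'
      · exact Or.inr ⟨c, List.mem_cons_of_mem _ hc, hc'⟩

theorem mem_of_mem_erase {k : ℕ} : ∀ (cs : List Cell) (c : Cell), c ∈ erase k cs → c ∈ cs := by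
  intro cs
  induction cs with
  | nil => exact fun c hc => hc
  | cons d cs ih =>
    intro c hc
    obtain ⟨m, l, u, ts⟩ := d
    rw [erase] at hc
    cases h : Nat.beq m k
    · rw [h, cond_false] at hc
      rcases List.mem_cons.1 hc with rfl | hc
      · exact List.mem_cons_self
      · exact List.mem_cons_of_mem _ (ih c hc)
    · rw [h, cond_true] at hc
      exact List.mem_cons_of_mem _ hc

theorem weight_erase {w : ℕ → ℕ} {k : ℕ} (hk : w k = 0) (p : ℕ → Bool) (cs : List Cell) :
    weight w p (erase k cs) = weight w p cs := by
  induction cs with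
  | nil => rfl
  | cons c cs ih =>
    obtain ⟨m, l, u, ts⟩ := c
    rw [erase]
    by_cases h : m = k
    · rw [natBeq_eq_decide, decide_eq_true h, cond_true, weight_cons]
      simp [h, hk]
    · rw [natBeq_eq_decide, decide_eq_false h, cond_false, weight_cons, weight_cons, ih]

theorem search_sound {w : ℕ → ℕ} {T R : ℕ} : ∀ (n : ℕ) (cs : List Cell) (L : ℕ → ℕ),
    search T R n cs = true → (∀ k, L k ≤ w k) → (∀ c ∈ cs, c.Ok w L) →
    weight w (meets T) cs ≤ R → weight w (fun _ => true) cs ≤ 31 := by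
  intro n
  induction n with
  | zero => exact fun cs L h => by simp [search] at h
  | succ n ih =>
    intro cs L h hL hok hR
    by_contra hlt
    have hsum := weight_le_hiSums T cs 0 0 hok
    have hadd := weight_add_weight_not w (meets T) cs
    rw [search] at h
    simp only at h
    set a := (hiSums T cs 0 0).1
    set b := (hiSums T cs 0 0).2
    -- The total is at most `b + min a R`, because the masks meeting `T` are bounded both by `a` and
    -- by `R`; so the pruning test cannot have succeeded.
    have hb : ¬Nat.add b (Nat.sub a (Nat.sub a R)) ≤ 31 := by
      have : Nat.add b (Nat.sub a (Nat.sub a R)) = b + (a - (a - R)) := rfl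
      omega
    rw [natBle_eq_decide, decide_eq_false hb, cond_false] at h
    set kx := pick cs 0 0 0 with hkx
    by_cases hx : kx.2 = 0
    · rw [natBeq_eq_decide, decide_eq_true hx, cond_true] at h
      cases h
    rw [natBeq_eq_decide, decide_eq_false hx, cond_false] at h
    rcases pick_spec cs 0 0 0 with hp | ⟨c, hc, hlo, hp⟩
    · rw [← hkx] at hp
      rw [hp] at hx
      exact hx rfl
    rw [← hkx] at hp
    have hk : kx.1 = c.mask := by rw [hp]
    have hx' : kx.2 = c.hi := by rw [hp]
    have hcok := hok c hc
    have hL0 : L kx.1 = 0 := by rw [hk, hcok.lo_eq, hlo]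
    have hwx : w kx.1 ≤ kx.2 := by
      rw [hk, hx']
      exact hcok.le_hi
    have step : ∀ l u, 1 ≤ l → l ≤ w kx.1 → w kx.1 ≤ u →
        (match assign kx.1 l u cs with
          | none => true
          | some r => search T R n r) = true → False := by
      intro l u hl hlw hwu hs
      obtain ⟨r, hr, hr', hw⟩ := assign_ok hL hL0 hl hlw hwu cs hok
      rw [hr] at hs
      have := ih r _ hs (fun j => by
        by_cases hj : j = kx.1
        · subst hj
          rwa [Function.update_self]
        · rw [Function.update_of_ne hj]
          exact hL j) hr' (by rwa [hw])
      rw [hw] at this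
      exact hlt this
    rw [Bool.and_eq_true, Bool.and_eq_true] at h
    obtain ⟨⟨h2, h1⟩, h0⟩ := h
    rcases Nat.lt_or_ge (w kx.1) 2 with hw2 | hw2
    · rcases Nat.eq_zero_or_pos (w kx.1) with hw0 | hw1
      · have := ih _ L h0 hL (fun c hc => hok c (mem_of_mem_erase _ c hc))
          (by rwa [weight_erase hw0])
        rw [weight_erase hw0] at this
        exact hlt this
      · exact step 1 1 le_rfl hw1 (by omega) h1
    · rw [natBeq_eq_decide, decide_eq_false (by omega), cond_false] at h2
      exact step 2 _ (by omega) hw2 hwx h2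

theorem restrict_ok {w L : ℕ → ℕ} {T r : ℕ} :
    ∀ cs : List Cell, (∀ c ∈ cs, c.Ok w L) →
      (∀ c ∈ cs, L c.mask = 0 → meets T c.mask = true → w c.mask ≤ r) →
      (∀ c ∈ restrict T r cs, c.Ok w L) ∧ ∀ p, weight w p (restrict T r cs) = weight w p cs := by
  intro cs
  induction cs with
  | nil => exact fun _ _ => ⟨by simp [restrict], fun _ => rfl⟩
  | cons c cs ih =>
    intro hc hT
    obtain ⟨ih1, ih2⟩ := ih (fun c hc' => hc c (List.mem_cons_of_mem _ hc'))
      fun c hc' => hT c (List.mem_cons_of_mem _ hc')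
    have c_ok := hc c List.mem_cons_self
    have hT' := hT c List.mem_cons_self
    obtain ⟨m, a, b, ts⟩ := c
    have keep : ∀ c' : Cell, c'.mask = m → c'.Ok w L →
        (∀ c ∈ c' :: restrict T r cs, c.Ok w L) ∧
          ∀ p, weight w p (c' :: restrict T r cs) = weight w p (⟨m, a, b, ts⟩ :: cs) := by
      intro c' hc' hok
      refine ⟨?_, fun p => by rw [weight_cons, weight_cons, ih2, hc']⟩
      intro c hc
      rcases List.mem_cons.1 hc with rfl | hc
      · exact hok
      · exact ih1 c hc
    obtain ⟨hm, hf, hlo, hlo', hhi, hinv⟩ := c_ok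
    simp only at hm hf hlo hlo' hhi hinv hT'
    rw [restrict]
    by_cases h : (Nat.beq a 0 && !(Nat.beq (Nat.land m T) 0)) = true
    · rw [h, cond_true]
      rw [Bool.and_eq_true, Nat.beq_eq] at h
      have hw := hT' (hlo.trans h.1) h.2
      by_cases hr : r = 0
      · rw [natBeq_eq_decide, decide_eq_true hr, cond_true]
        refine ⟨ih1, fun p => ?_⟩
        have : w m = 0 := by omega
        rw [weight_cons, ih2]
        simp [this]
      · rw [natBeq_eq_decide, decide_eq_false hr, cond_false]
        refine keep _ rfl ⟨hm, hf, hlo, hlo', ?_, hinv⟩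
        have : Nat.sub b (Nat.sub b r) = b - (b - r) := rfl
        simp only [this]
        omega
    · rw [Bool.not_eq_true] at h
      rw [h, cond_false]
      exact keep _ rfl ⟨hm, hf, hlo, hlo', hhi, hinv⟩

theorem searchFrom_eq_true {z : ℕ} (h2 : 2 ≤ z) (h7 : z ≤ 7) : searchFrom z = true := by
  interval_cases z
  exacts [searchFrom_two, searchFrom_three, searchFrom_four, searchFrom_five, searchFrom_six,
    searchFrom_seven]

/-- If the heaviest mask is the standard one and has too few cubes for the corners in a
representative set, then some mask is fillable. -/
theorem exists_fillable {w : ℕ → ℕ} (hsum : 32 ≤ (masks.map w).sum)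
    (hmax : ∀ k ∈ masks, w k ≤ w stdMask) {p : ℕ × ℕ} (hp : p ∈ cornerSets)
    (hT : (masks.map fun k => bif meets p.2 k then w k else 0).sum < p.1) :
    ∃ m ∈ masks, Fillable w m := by
  by_contra hcon
  push Not at hcon
  obtain ⟨t, T⟩ := p
  simp only at hT
  have hsize : ∀ p ∈ cornerSets, p.1 ≤ 8 ∧ meets p.2 stdMask = true := by decide +kernel
  obtain ⟨ht, hstd⟩ := hsize _ hp
  simp only at ht hstd
  have hpair : ∀ k ∈ otherMasks, meets T k = true → w k + w stdMask < t := by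
    intro k hk hkT
    rw [masks, List.map_cons, List.sum_cons, hstd, cond_true] at hT
    have hle := List.single_le_sum
      (l := otherMasks.map fun k => bif meets T k then w k else 0)
      (fun _ _ => Nat.zero_le _) _ (List.mem_map_of_mem hk)
    simp only [hkT, cond_true] at hle
    omega
  have hz : w stdMask < t := by
    rw [masks, List.map_cons, List.sum_cons, hstd, cond_true] at hT
    omega
  -- Thirty masks of weight at most 1 cannot reach total 32.
  have hz2 : 2 ≤ w stdMask := by
    by_contra hlt
    have : (masks.map w).sum ≤ masks.length • 1 := by
      have := List.sum_le_card_nsmul (masks.map w) 1 (by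
        intro x hx
        obtain ⟨k, hk, rfl⟩ := List.mem_map.1 hx
        have := hmax k hk
        omega)
      rwa [List.length_map] at this
    have hlen : masks.length = 30 := rfl
    rw [hlen] at this
    simp only [smul_eq_mul] at this
    omega
  set z := w stdMask with hzdef
  have hinit : ∀ c ∈ masks.map fun k => (⟨k, 0, z, singles k⟩ : Cell), c.Ok w fun _ => 0 := by
    intro c hc
    obtain ⟨k, hk, rfl⟩ := List.mem_map.1 hc
    exact ⟨hk, hcon k hk, rfl, Nat.zero_le _, hmax k hk, treeInv_singles k⟩
  have hweight : ∀ p, weight w p (masks.map fun k => (⟨k, 0, z, singles k⟩ : Cell)) =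
      (masks.map fun k => bif p k then w k else 0).sum := by
    intro p
    rw [weight, List.map_map]
    rfl
  obtain ⟨r, hr, hok, hw⟩ := assign_ok (h := z) (k := stdMask) (l := z) (fun _ => Nat.zero_le _)
    rfl (by omega) hzdef.le hzdef.ge _ hinit
  have hs := searchFrom_eq_true hz2 (show z ≤ 7 by omega)
  rw [searchFrom, show initial z = some r from hr] at hs
  have hs' := List.all_eq_true.1 hs _ hp
  simp only at hs'
  rw [natBle_eq_decide, decide_eq_false (by omega), cond_false] at hs'
  obtain ⟨hok', hw'⟩ := restrict_ok (T := T) (r := Nat.sub (Nat.pred t) z) r hok (by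
    intro c hc h0 hcT
    have hcm := (hok c hc).mem
    have hne : c.mask ≠ stdMask := by
      intro he
      rw [he, Function.update_self] at h0
      omega
    have hmem : c.mask ∈ otherMasks := by
      rcases List.mem_cons.1 hcm with h | h
      · exact (hne h).elim
      · exact h
    have := hpair _ hmem hcT
    have e : Nat.sub (Nat.pred t) z = t - 1 - z := rfl
    omega)
  have hfin := search_sound _ _ _ hs' (fun j => by
    by_cases hj : j = stdMask
    · subst hj
      rw [Function.update_self]
    · rw [Function.update_of_ne hj]
      exact Nat.zero_le _) hok' (by
    rw [hw', hw, hweight]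
    have e : Nat.pred t = t - 1 := rfl
    omega)
  rw [hw', hw, hweight] at hfin
  simp only [cond_true] at hfin
  have e : (masks.map fun k => w k) = masks.map w := rfl
  rw [e] at hfin
  omega

/-! ### Corner masks of colored cubes -/

/-- The coloring of the faces `(0, 1), (0, -1), (1, 1), …` by `0, 1, 2, …`. -/
def stdCube : ColoredCube where
  toFun f := ⟨2 * f.1 + if f.2 = 1 then 0 else 1, by have := f.1.2; split_ifs <;> omega⟩
  invFun i := (⟨i / 2, by omega⟩, if (i : ℕ) % 2 = 0 then 1 else -1)
  left_inv := by unfold Function.LeftInverse; decide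
  right_inv := by unfold Function.RightInverse Function.LeftInverse; decide

/-- A code of the cyclically ordered triple `a, b, c` of numbers below 6. -/
def cyclicCode (a b c : ℕ) : ℕ :=
  if a < b ∧ a < c then 36 * a + 6 * b + c
  else if b < a ∧ b < c then 36 * b + 6 * c + a
  else 36 * c + 6 * a + b

/-- The code of the colors around the corner with signs `s`, in positive order. -/
def cornerCode (C : ColoredCube) (s : Fin 3 → ℤˣ) : ℕ :=
  if s 0 * s 1 * s 2 = 1 then cyclicCode (C (0, s 0)) (C (1, s 1)) (C (2, s 2))
  else cyclicCode (C (1, s 1)) (C (0, s 0)) (C (2, s 2))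

def maskOf (a b c d e f : ℕ) : ℕ :=
  2 ^ cyclicCode a c e ||| 2 ^ cyclicCode c a f ||| 2 ^ cyclicCode d a e ||| 2 ^ cyclicCode a d f |||
  2 ^ cyclicCode c b e ||| 2 ^ cyclicCode b c f ||| 2 ^ cyclicCode b d e ||| 2 ^ cyclicCode d b f

/-- The set of the codes of the eight corners of a colored cube. -/
def mask (C : ColoredCube) : ℕ :=
  maskOf (C (0, 1)) (C (0, -1)) (C (1, 1)) (C (1, -1)) (C (2, 1)) (C (2, -1))

theorem signs_eq (s : Fin 3 → ℤˣ) : s = ![s 0, s 1, s 2] := by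
  funext k
  fin_cases k <;> rfl

theorem testBit_mask {C : ColoredCube} {v : ℕ} :
    (mask C).testBit v = true ↔ ∃ s, cornerCode C s = v := by
  simp only [mask, maskOf, Nat.testBit_or, Nat.testBit_two_pow, Bool.or_eq_true, decide_eq_true_eq]
  constructor
  · rintro (((((((h | h) | h) | h) | h) | h) | h) | h)
    · exact ⟨![1, 1, 1], h⟩
    · exact ⟨![1, 1, -1], by rwa [cornerCode, if_neg (by decide)]⟩
    · exact ⟨![1, -1, 1], by rwa [cornerCode, if_neg (by decide)]⟩
    · exact ⟨![1, -1, -1], by rwa [cornerCode, if_pos (by decide)]⟩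
    · exact ⟨![-1, 1, 1], by rwa [cornerCode, if_neg (by decide)]⟩
    · exact ⟨![-1, 1, -1], by rwa [cornerCode, if_pos (by decide)]⟩
    · exact ⟨![-1, -1, 1], by rwa [cornerCode, if_pos (by decide)]⟩
    · exact ⟨![-1, -1, -1], by rwa [cornerCode, if_neg (by decide)]⟩
  · rintro ⟨s, rfl⟩
    rw [signs_eq s]
    rcases Int.units_eq_one_or (s 0) with h0 | h0 <;> rcases Int.units_eq_one_or (s 1) with h1 | h1 <;>
      rcases Int.units_eq_one_or (s 2) with h2 | h2 <;> rw [h0, h1, h2]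
    · exact Or.inl (Or.inl (Or.inl (Or.inl (Or.inl (Or.inl (Or.inl rfl))))))
    · exact Or.inl (Or.inl (Or.inl (Or.inl (Or.inl (Or.inl (Or.inr rfl))))))
    · exact Or.inl (Or.inl (Or.inl (Or.inl (Or.inl (Or.inr rfl)))))
    · exact Or.inl (Or.inl (Or.inl (Or.inl (Or.inr rfl))))
    · exact Or.inl (Or.inl (Or.inl (Or.inr rfl)))
    · exact Or.inl (Or.inl (Or.inr rfl))
    · exact Or.inl (Or.inr rfl)
    · exact Or.inr rfl

/-- The corner `s'` of `C` can be rotated to the corner `s` of `M` such that the colors agree. -/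
def SameCorner (C : ColoredCube) (s' : Fin 3 → ℤˣ) (M : ColoredCube) (s : Fin 3 → ℤˣ) : Prop :=
  ∃ σ : Equiv.Perm (Fin 3), Equiv.Perm.sign σ = (∏ k, s k) * ∏ k, s' k ∧
    ∀ k, C (k, s' k) = M (σ k, s (σ k))

theorem cyclicCode_eq_iff {a b c x y z : ℕ} (ha : a < 6) (hb : b < 6) (hc : c < 6) (hx : x < 6)
    (hy : y < 6) (hz : z < 6) (_ : a ≠ b) (_ : a ≠ c) (_ : b ≠ c) (hxy : x ≠ y)
    (hxz : x ≠ z) (hyz : y ≠ z) : cyclicCode a b c = cyclicCode x y z ↔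
      (a = x ∧ b = y ∧ c = z) ∨ (a = y ∧ b = z ∧ c = x) ∨ (a = z ∧ b = x ∧ c = y) := by
  unfold cyclicCode
  split_ifs <;> omega

theorem perm_fin_three (σ : Equiv.Perm (Fin 3)) :
    (Equiv.Perm.sign σ = 1 ∧ ((σ 0 = 0 ∧ σ 1 = 1 ∧ σ 2 = 2) ∨ (σ 0 = 1 ∧ σ 1 = 2 ∧ σ 2 = 0) ∨
      (σ 0 = 2 ∧ σ 1 = 0 ∧ σ 2 = 1))) ∨
    (Equiv.Perm.sign σ = -1 ∧ ((σ 0 = 1 ∧ σ 1 = 0 ∧ σ 2 = 2) ∨ (σ 0 = 0 ∧ σ 1 = 2 ∧ σ 2 = 1) ∨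
      (σ 0 = 2 ∧ σ 1 = 1 ∧ σ 2 = 0))) := by
  revert σ
  decide

theorem exists_perm_of_sign (p : ℤˣ) {P : Fin 3 → Fin 3 → Fin 3 → Prop}
    (h : (p = 1 ∧ (P 0 1 2 ∨ P 1 2 0 ∨ P 2 0 1)) ∨ (p = -1 ∧ (P 1 0 2 ∨ P 0 2 1 ∨ P 2 1 0))) :
    ∃ σ : Equiv.Perm (Fin 3), Equiv.Perm.sign σ = p ∧ P (σ 0) (σ 1) (σ 2) := by
  rcases h with ⟨rfl, h | h | h⟩ | ⟨rfl, h | h | h⟩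
  · exact ⟨1, by decide, h⟩
  · exact ⟨finRotate 3, by decide, h⟩
  · exact ⟨(finRotate 3)⁻¹, by decide, h⟩
  · exact ⟨Equiv.swap 0 1, by decide, h⟩
  · exact ⟨Equiv.swap 1 2, by decide, h⟩
  · exact ⟨Equiv.swap 0 2, by decide, h⟩

theorem sameCorner_iff_aux (C : ColoredCube) (s' : Fin 3 → ℤˣ) (M : ColoredCube)
    (s : Fin 3 → ℤˣ) : SameCorner C s' M s ↔
      ∃ σ : Equiv.Perm (Fin 3), Equiv.Perm.sign σ = (∏ k, s k) * ∏ k, s' k ∧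
        (C (0, s' 0) = M (σ 0, s (σ 0)) ∧ C (1, s' 1) = M (σ 1, s (σ 1)) ∧
          C (2, s' 2) = M (σ 2, s (σ 2))) := by
  simp only [SameCorner, Fin.forall_fin_succ, Fin.succ_zero_eq_one, Fin.succ_one_eq_two,
    IsEmpty.forall_iff, and_true]

/-- The code forgets exactly the cyclic rotations, which are the even permutations of the three
axes. Corners of opposite sign list their axes in opposite orientation, which explains the sign in
`SameCorner`. -/
theorem cornerCode_eq_iff {C M : ColoredCube} {s' s : Fin 3 → ℤˣ} :
    cornerCode C s' = cornerCode M s ↔ SameCorner C s' M s := by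
  have hne : ∀ (D : ColoredCube) (t : Fin 3 → ℤˣ) (i j : Fin 3), i ≠ j →
      (D (i, t i) : ℕ) ≠ D (j, t j) := fun D t i j hij h =>
    hij (congrArg Prod.fst (D.injective (Fin.ext h)))
  have key := fun (i j k x y z : Fin 3) (hij : i ≠ j) (hik : i ≠ k) (hjk : j ≠ k) (hxy : x ≠ y)
      (hxz : x ≠ z) (hyz : y ≠ z) => cyclicCode_eq_iff (C (i, s' i)).2 (C (j, s' j)).2
    (C (k, s' k)).2 (M (x, s x)).2 (M (y, s y)).2 (M (z, s z)).2 (hne C s' i j hij)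
    (hne C s' i k hik) (hne C s' j k hjk) (hne M s x y hxy) (hne M s x z hxz) (hne M s y z hyz)
  simp only [← Fin.ext_iff] at key
  have hp : ∀ t : Fin 3 → ℤˣ, ∏ k, t k = t 0 * t 1 * t 2 := fun t => Fin.prod_univ_three t
  rw [sameCorner_iff_aux]
  simp only [cornerCode, hp]
  constructor
  · intro h
    apply exists_perm_of_sign _ (P := fun a b c => C (0, s' 0) = M (a, s a) ∧
      C (1, s' 1) = M (b, s b) ∧ C (2, s' 2) = M (c, s c))
    rcases Int.units_eq_one_or (s' 0 * s' 1 * s' 2) with h1 | h1 <;>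
      rcases Int.units_eq_one_or (s 0 * s 1 * s 2) with h2 | h2 <;>
      simp only [h1, h2, if_true, if_neg (show (-1 : ℤˣ) ≠ 1 by decide)] at h ⊢
    · rw [key 0 1 2 0 1 2 (by decide) (by decide) (by decide) (by decide) (by decide)
        (by decide)] at h
      exact Or.inl ⟨by simp, h⟩
    · rw [key 0 1 2 1 0 2 (by decide) (by decide) (by decide) (by decide) (by decide)
        (by decide)] at h
      exact Or.inr ⟨by simp, h⟩
    · rw [key 1 0 2 0 1 2 (by decide) (by decide) (by decide) (by decide) (by decide)
        (by decide)] at h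
      refine Or.inr ⟨by simp, ?_⟩
      rcases h with ⟨a, b, c⟩ | ⟨a, b, c⟩ | ⟨a, b, c⟩
      exacts [Or.inl ⟨b, a, c⟩, Or.inr (Or.inr ⟨b, a, c⟩), Or.inr (Or.inl ⟨b, a, c⟩)]
    · rw [key 1 0 2 1 0 2 (by decide) (by decide) (by decide) (by decide) (by decide)
        (by decide)] at h
      refine Or.inl ⟨by simp, ?_⟩
      rcases h with ⟨a, b, c⟩ | ⟨a, b, c⟩ | ⟨a, b, c⟩
      exacts [Or.inl ⟨b, a, c⟩, Or.inr (Or.inr ⟨b, a, c⟩), Or.inr (Or.inl ⟨b, a, c⟩)]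
  · rintro ⟨σ, hσ, h⟩
    rcases Int.units_eq_one_or (s' 0 * s' 1 * s' 2) with h1 | h1 <;>
      rcases Int.units_eq_one_or (s 0 * s 1 * s 2) with h2 | h2 <;>
      simp only [h1, h2, if_true, if_neg (show (-1 : ℤˣ) ≠ 1 by decide)] at hσ ⊢
    · rw [key 0 1 2 0 1 2 (by decide) (by decide) (by decide) (by decide) (by decide)
        (by decide)]
      rcases perm_fin_three σ with ⟨hs, ⟨a, b, c⟩ | ⟨a, b, c⟩ | ⟨a, b, c⟩⟩ | ⟨hs, -⟩
      · rw [a, b, c] at h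
        exact Or.inl h
      · rw [a, b, c] at h
        exact Or.inr (Or.inl h)
      · rw [a, b, c] at h
        exact Or.inr (Or.inr h)
      · rw [hs] at hσ
        exact absurd hσ (by decide)
    · rw [key 0 1 2 1 0 2 (by decide) (by decide) (by decide) (by decide) (by decide)
        (by decide)]
      rcases perm_fin_three σ with ⟨hs, -⟩ | ⟨hs, ⟨a, b, c⟩ | ⟨a, b, c⟩ | ⟨a, b, c⟩⟩
      · rw [hs] at hσ
        exact absurd hσ (by decide)
      · rw [a, b, c] at h
        exact Or.inl h
      · rw [a, b, c] at h
        exact Or.inr (Or.inl h)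
      · rw [a, b, c] at h
        exact Or.inr (Or.inr h)
    · rw [key 1 0 2 0 1 2 (by decide) (by decide) (by decide) (by decide) (by decide)
        (by decide)]
      rcases perm_fin_three σ with ⟨hs, -⟩ | ⟨hs, ⟨a, b, c⟩ | ⟨a, b, c⟩ | ⟨a, b, c⟩⟩
      · rw [hs] at hσ
        exact absurd hσ (by decide)
      · rw [a, b, c] at h
        exact Or.inl ⟨h.2.1, h.1, h.2.2⟩
      · rw [a, b, c] at h
        exact Or.inr (Or.inr ⟨h.2.1, h.1, h.2.2⟩)
      · rw [a, b, c] at h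
        exact Or.inr (Or.inl ⟨h.2.1, h.1, h.2.2⟩)
    · rw [key 1 0 2 1 0 2 (by decide) (by decide) (by decide) (by decide) (by decide)
        (by decide)]
      rcases perm_fin_three σ with ⟨hs, ⟨a, b, c⟩ | ⟨a, b, c⟩ | ⟨a, b, c⟩⟩ | ⟨hs, -⟩
      · rw [a, b, c] at h
        exact Or.inl ⟨h.2.1, h.1, h.2.2⟩
      · rw [a, b, c] at h
        exact Or.inr (Or.inr ⟨h.2.1, h.1, h.2.2⟩)
      · rw [a, b, c] at h
        exact Or.inr (Or.inl ⟨h.2.1, h.1, h.2.2⟩)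
      · rw [hs] at hσ
        exact absurd hσ (by decide)

/-- The cube `C` can be rotated to show the colors of `M` at the corner `s`. -/
def Sees (C M : ColoredCube) (s : Fin 3 → ℤˣ) : Prop := (mask C).testBit (cornerCode M s) = true

instance (C M : ColoredCube) (s : Fin 3 → ℤˣ) : Decidable (Sees C M s) :=
  inferInstanceAs (Decidable (_ = true))

theorem sees_iff {C M : ColoredCube} {s : Fin 3 → ℤˣ} :
    Sees C M s ↔ ∃ s', SameCorner C s' M s := by
  simp only [Sees, testBit_mask, cornerCode_eq_iff]

theorem sameCorner_trans_iff {C M : ColoredCube} {s' s : Fin 3 → ℤˣ} (π : Equiv.Perm (Fin 6)) :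
    SameCorner (C.trans π) s' (M.trans π) s ↔ SameCorner C s' M s := by
  simp [SameCorner]

theorem sees_trans_iff {C M : ColoredCube} {s : Fin 3 → ℤˣ} (π : Equiv.Perm (Fin 6)) :
    Sees (C.trans π) (M.trans π) s ↔ Sees C M s := by
  simp only [sees_iff, sameCorner_trans_iff]

theorem mask_eq_iff {C D : ColoredCube} :
    mask C = mask D ↔ (∀ s, Sees C D s) ∧ ∀ s, Sees D C s := by
  constructor
  · intro h
    exact ⟨fun s => by rw [Sees, h, testBit_mask]; exact ⟨s, rfl⟩,
      fun s => by rw [Sees, ← h, testBit_mask]; exact ⟨s, rfl⟩⟩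
  · rintro ⟨h1, h2⟩
    apply Nat.eq_of_testBit_eq
    intro v
    rw [Bool.eq_iff_iff]
    constructor <;> intro h <;> obtain ⟨s, rfl⟩ := testBit_mask.1 h
    · exact h2 s
    · exact h1 s

/-- Renaming colors therefore permutes the types of cubes, so any chosen cube may be taken to be the
standard one. -/
theorem mask_trans_eq_iff {C D : ColoredCube} (π : Equiv.Perm (Fin 6)) :
    mask (C.trans π) = mask (D.trans π) ↔ mask C = mask D := by
  simp only [mask_eq_iff, sees_trans_iff]

theorem cornerCode_injective (C : ColoredCube) : Function.Injective (cornerCode C) := by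
  intro s t h
  obtain ⟨σ, -, hσ⟩ := cornerCode_eq_iff.1 h
  funext k
  have := C.injective (hσ k)
  simp only [Prod.mk.injEq] at this
  rw [this.2, ← this.1]

theorem mask_stdCube : mask stdCube = stdMask := by decide +kernel

theorem maskOf_mem_masks : ∀ a b : Fin 6, a ≠ b → ∀ c, a ≠ c → b ≠ c → ∀ d, a ≠ d → b ≠ d →
    c ≠ d → ∀ e, a ≠ e → b ≠ e → c ≠ e → d ≠ e → ∀ f, a ≠ f → b ≠ f → c ≠ f → d ≠ f → e ≠ f →
    maskOf a b c d e f ∈ masks := by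
  decide +kernel

theorem mask_mem_masks (C : ColoredCube) : mask C ∈ masks := by
  apply maskOf_mem_masks <;> exact fun h => absurd (C.injective h) (by decide)

theorem cornerCode_lt (C : ColoredCube) (s : Fin 3 → ℤˣ) : cornerCode C s < 144 := by
  have h0 := C.injective.ne (show ((0 : Fin 3), s 0) ≠ (1, s 1) by simp)
  have h1 := C.injective.ne (show ((0 : Fin 3), s 0) ≠ (2, s 2) by simp)
  have h2 := C.injective.ne (show ((1 : Fin 3), s 1) ≠ (2, s 2) by simp)
  rw [Ne, Fin.ext_iff] at h0 h1 h2
  have := (C (0, s 0)).2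
  have := (C (1, s 1)).2
  have := (C (2, s 2)).2
  unfold cornerCode cyclicCode
  split_ifs <;> omega

theorem mem_bits_mask {C : ColoredCube} {v : ℕ} : v ∈ bits (mask C) ↔ ∃ s, cornerCode C s = v := by
  rw [bits, Finset.mem_filter, Finset.mem_range, testBit_mask]
  constructor
  · exact fun h => h.2
  · rintro ⟨s, rfl⟩
    exact ⟨cornerCode_lt C s, s, rfl⟩

/-! ### Rotations -/

def signedPerm (σ : Equiv.Perm (Fin 3)) (ε : Fin 3 → ℤˣ) : Equiv.Perm CubeFace where
  toFun f := (σ f.1, ε f.1 * f.2)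
  invFun f := (σ.symm f.1, ε (σ.symm f.1) * f.2)
  left_inv f := by simp [← mul_assoc]
  right_inv f := by simp [← mul_assoc]

theorem signedPerm_apply (σ : Equiv.Perm (Fin 3)) (ε : Fin 3 → ℤˣ) (f : CubeFace) :
    signedPerm σ ε f = (σ f.1, ε f.1 * f.2) := rfl

theorem isRotation_signedPerm {σ : Equiv.Perm (Fin 3)} {ε : Fin 3 → ℤˣ}
    (h : Equiv.Perm.sign σ * ∏ i, ε i = 1) : IsRotation (signedPerm σ ε) :=
  ⟨σ, ε, h, fun _ _ => rfl⟩

/-- The image of the corner with signs `s` under a signed permutation. -/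
def moveCorner (σ : Equiv.Perm (Fin 3)) (ε : Fin 3 → ℤˣ) (s : Fin 3 → ℤˣ) : Fin 3 → ℤˣ :=
  fun j => ε (σ.symm j) * s (σ.symm j)

theorem sameCorner_moveCorner {σ : Equiv.Perm (Fin 3)} {ε : Fin 3 → ℤˣ}
    (h : Equiv.Perm.sign σ * ∏ i, ε i = 1) (C : ColoredCube) (s : Fin 3 → ℤˣ) :
    SameCorner ((signedPerm σ ε).trans C) s C (moveCorner σ ε s) := by
  refine ⟨σ, ?_, fun k => ?_⟩
  · have : ∏ k, moveCorner σ ε s k = (∏ k, ε k) * ∏ k, s k := by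
      rw [← Finset.prod_mul_distrib]
      exact Equiv.prod_comp σ.symm fun k => ε k * s k
    rw [this, mul_assoc, Int.units_mul_self, mul_one]
    have := congrArg (· * ∏ i, ε i) h
    simpa [mul_assoc] using this
  · simp [moveCorner, signedPerm_apply]

theorem exists_moveCorner_eq (σ : Equiv.Perm (Fin 3)) (ε s : Fin 3 → ℤˣ) :
    ∃ s', moveCorner σ ε s' = s :=
  ⟨fun k => ε k * s (σ k), by funext j; simp [moveCorner, ← mul_assoc]⟩

theorem mask_signedPerm_trans {σ : Equiv.Perm (Fin 3)} {ε : Fin 3 → ℤˣ}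
    (h : Equiv.Perm.sign σ * ∏ i, ε i = 1) (C : ColoredCube) :
    mask ((signedPerm σ ε).trans C) = mask C := by
  rw [mask_eq_iff]
  constructor <;> intro s
  · obtain ⟨s', rfl⟩ := exists_moveCorner_eq σ ε s
    exact sees_iff.2 ⟨s', sameCorner_moveCorner h C s'⟩
  · exact sees_iff.2 ⟨moveCorner σ ε s,
      cornerCode_eq_iff.1 (cornerCode_eq_iff.2 (sameCorner_moveCorner h C s)).symm⟩

/-- The sign condition in `SameCorner` says precisely that the signed permutation matching the two
corners has determinant 1. -/
theorem Sees.exists_rotation {C M : ColoredCube} {s : Fin 3 → ℤˣ} (h : Sees C M s) :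
    ∃ g, IsRotation g ∧ ∀ k, C (g.symm (k, s k)) = M (k, s k) := by
  obtain ⟨s', σ, hσ, hc⟩ := sees_iff.1 h
  refine ⟨signedPerm σ fun k => s (σ k) * s' k, isRotation_signedPerm ?_, fun j => ?_⟩
  · rw [Finset.prod_mul_distrib, Equiv.prod_comp σ s, hσ, Int.units_mul_self]
  · have : (signedPerm σ fun k => s (σ k) * s' k).symm (j, s j) = (σ.symm j, s' (σ.symm j)) := by
      rw [Equiv.symm_apply_eq, signedPerm_apply]
      simp [mul_assoc]
    rw [this, hc]
    simp

/-- The colors `a` and `b` lie on the same axis of `C`. -/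
def Opp (C : ColoredCube) (a b : Fin 6) : Prop := (C.symm a).1 = (C.symm b).1

instance (C : ColoredCube) (a b : Fin 6) : Decidable (Opp C a b) :=
  inferInstanceAs (Decidable (_ = _))

/-- Two axes and their signs are prescribed; the sign on the third is free and is used to make the
determinant 1. -/
theorem exists_rotation_of_not_opp {C M : ColoredCube} {f g : CubeFace} (hfg : f.1 ≠ g.1)
    (h : ¬Opp C (M f) (M g)) :
    ∃ r, IsRotation r ∧ C (r.symm f) = M f ∧ C (r.symm g) = M g := by
  obtain ⟨⟨i, u⟩, hx⟩ : ∃ x, x = C.symm (M f) := ⟨_, rfl⟩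
  obtain ⟨⟨j, v⟩, hy⟩ : ∃ y, y = C.symm (M g) := ⟨_, rfl⟩
  have hij : i ≠ j := by
    rw [Opp, ← hx, ← hy] at h
    exact h
  obtain ⟨k, p⟩ := f
  obtain ⟨l, q⟩ := g
  simp only at hfg
  obtain ⟨σ, rfl, rfl⟩ : ∃ σ : Equiv.Perm (Fin 3), σ i = k ∧ σ j = l := by
    clear hx hy h
    revert i j k l
    decide
  set ε : Fin 3 → ℤˣ := fun a =>
    if a = i then p * u else if a = j then q * v else Equiv.Perm.sign σ * (p * u) * (q * v) with hε
  have hprod : ∀ x y z : ℤˣ, ∏ a, (if a = i then x else if a = j then y else z) = x * y * z := by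
    clear hx hy h hfg hε
    clear ε σ
    revert i j
    decide
  refine ⟨signedPerm σ ε, isRotation_signedPerm ?_, ?_, ?_⟩
  · rw [hε, hprod]
    rcases Int.units_eq_one_or (Equiv.Perm.sign σ) with h1 | h1 <;>
      rcases Int.units_eq_one_or (p * u) with h2 | h2 <;>
      rcases Int.units_eq_one_or (q * v) with h3 | h3 <;> simp [h1, h2, h3]
  · have : (signedPerm σ ε).symm (σ i, p) = (i, u) := by
      rw [Equiv.symm_apply_eq, signedPerm_apply]
      simp [hε, mul_assoc]
    rw [this, hx]
    simp
  · have : (signedPerm σ ε).symm (σ j, q) = (j, v) := by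
      rw [Equiv.symm_apply_eq, signedPerm_apply]
      simp [hε, mul_assoc, Ne.symm hij]
    rw [this, hy]
    simp

/-- Two colors on different axes of `C` meet at a corner of `C`. Equal masks give this corner on
`D`, so the colors are on different axes there too. -/
theorem Opp.of_mask_eq {C D : ColoredCube} (h : mask C = mask D) {a b : Fin 6} (hD : Opp D a b) :
    Opp C a b := by
  by_contra hC
  obtain ⟨⟨i, u⟩, hx⟩ : ∃ x, x = C.symm a := ⟨_, rfl⟩
  obtain ⟨⟨j, v⟩, hy⟩ : ∃ y, y = C.symm b := ⟨_, rfl⟩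
  have hij : i ≠ j := by
    rw [Opp, ← hx, ← hy] at hC
    exact hC
  have hsee := (mask_eq_iff.1 h).2 fun k => if k = i then u else v
  obtain ⟨s', hs'⟩ := sees_iff.1 hsee
  obtain ⟨σ, -, hσ⟩ := cornerCode_eq_iff.1 (cornerCode_eq_iff.2 hs').symm
  have hi := hσ i
  have hj := hσ j
  simp only [if_true, if_neg (Ne.symm hij)] at hi hj
  rw [hx, Equiv.apply_symm_apply] at hi
  rw [hy, Equiv.apply_symm_apply] at hj
  rw [Opp, hi, hj, Equiv.symm_apply_apply, Equiv.symm_apply_apply] at hD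
  exact hij (σ.injective hD)

/-- The mirror image of a colored cube. -/
def mirror (C : ColoredCube) : ColoredCube :=
  (signedPerm 1 fun k => if k = 0 then -1 else 1).trans C

theorem opp_mirror {C : ColoredCube} {a b : Fin 6} : Opp (mirror C) a b ↔ Opp C a b := by
  simp [Opp, mirror, signedPerm]

theorem mask_signedPerm_trans_of_neg {σ : Equiv.Perm (Fin 3)} {ε : Fin 3 → ℤˣ}
    (h : Equiv.Perm.sign σ * ∏ i, ε i = -1) (C : ColoredCube) :
    mask ((signedPerm σ ε).trans C) = mask (mirror C) := by
  set δ : Fin 3 → ℤˣ := fun k => if k = 0 then -1 else 1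
  have hδ : ∏ k, δ k = -1 := by decide
  have hC : (signedPerm σ ε).trans C =
      (signedPerm σ fun k => ε k * δ (σ k)).trans (mirror C) := by
    ext ⟨k, t⟩
    have : δ (σ k) * (ε k * δ (σ k) * t) = ε k * t := by
      rw [mul_comm (ε k), mul_assoc, ← mul_assoc, Int.units_mul_self, one_mul]
    simp only [mirror, Equiv.trans_apply, signedPerm_apply, Equiv.Perm.one_apply]
    rw [this]
  rw [hC]
  apply mask_signedPerm_trans
  rw [Finset.prod_mul_distrib, Equiv.prod_comp σ δ, hδ, mul_neg, mul_one, mul_neg, h, neg_neg]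

theorem not_three_on_axis : ∀ x y z : CubeFace, x ≠ y → x ≠ z → y ≠ z → x.1 = y.1 → x.1 ≠ z.1 := by
  decide

/-- A face permutation preserving opposite pairs permutes the axes, as an axis has room for only two
faces. -/
theorem exists_signedPerm_eq {h : Equiv.Perm CubeFace}
    (hh : ∀ k, (h (k, 1)).1 = (h (k, -1)).1) : ∃ σ ε, h = signedPerm σ ε := by
  have hinj : Function.Injective fun k => (h (k, 1)).1 := by
    intro k l hkl
    by_contra hne
    exact not_three_on_axis (h (k, 1)) (h (k, -1)) (h (l, 1)) (h.injective.ne (by simp))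
      (h.injective.ne (by simp [hne])) (h.injective.ne (by simp)) (hh k) hkl
  refine ⟨Equiv.ofBijective _ (Finite.injective_iff_bijective.1 hinj), fun k => (h (k, 1)).2, ?_⟩
  ext1 ⟨k, t⟩
  rw [signedPerm_apply, Equiv.ofBijective_apply]
  rcases Int.units_eq_one_or t with rfl | rfl
  · simp
  · refine Prod.ext (hh k).symm ?_
    have hne : (h (k, 1)).2 ≠ (h (k, -1)).2 := fun he =>
      h.injective.ne (show ((k, 1) : CubeFace) ≠ (k, -1) by simp) (Prod.ext (hh k) he)
    simp only
    rcases Int.units_eq_one_or (h (k, 1)).2 with h1 | h1 <;>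
      rcases Int.units_eq_one_or (h (k, -1)).2 with h2 | h2 <;> rw [h1, h2] at hne ⊢ <;> simp at hne ⊢

theorem mask_eq_or_of_opp {C D : ColoredCube} (h : ∀ k, Opp D (C (k, 1)) (C (k, -1))) :
    mask C = mask D ∨ mask C = mask (mirror D) := by
  obtain ⟨σ, ε, hσ⟩ := exists_signedPerm_eq (h := C.trans D.symm) h
  have hC : C = (signedPerm σ ε).trans D := by
    rw [← hσ]
    ext
    simp
  rcases Int.units_eq_one_or (Equiv.Perm.sign σ * ∏ i, ε i) with h1 | h1
  · left
    conv_lhs => rw [hC]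
    exact mask_signedPerm_trans h1 D
  · right
    conv_lhs => rw [hC]
    exact mask_signedPerm_trans_of_neg h1 D

theorem opp_faces {C D : ColoredCube} {a b : Fin 6} (hab : a ≠ b) (hC : Opp C a b)
    (hD : Opp D a b) : Opp D (C ((C.symm a).1, 1)) (C ((C.symm a).1, -1)) := by
  obtain ⟨⟨i, u⟩, hx⟩ : ∃ x, C x = a := ⟨C.symm a, by simp⟩
  obtain ⟨⟨j, v⟩, hy⟩ : ∃ y, C y = b := ⟨C.symm b, by simp⟩
  subst hx hy
  simp only [Opp, Equiv.symm_apply_apply] at hC hD ⊢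
  subst hC
  have huv : u ≠ v := fun h => hab (by rw [h])
  rcases Int.units_eq_one_or u with rfl | rfl <;> rcases Int.units_eq_one_or v with rfl | rfl
  · exact absurd rfl huv
  · exact hD
  · exact hD.symm
  · exact absurd rfl huv

/-- Two pairs of opposite colors determine a colored cube up to rotations and reflections. -/
theorem mask_eq_or_of_two_opp {C D : ColoredCube} {a b c d : Fin 6} (hab : a ≠ b) (hcd : c ≠ d)
    (hac : ¬Opp C a c) (hCab : Opp C a b) (hCcd : Opp C c d) (hDab : Opp D a b)
    (hDcd : Opp D c d) : mask C = mask D ∨ mask C = mask (mirror D) := by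
  apply mask_eq_or_of_opp
  have hi := opp_faces hab hCab hDab
  have hj := opp_faces hcd hCcd hDcd
  unfold Opp at hac
  set i := (C.symm a).1
  set j := (C.symm c).1
  intro k
  by_cases hki : k = i
  · rwa [hki]
  by_cases hkj : k = j
  · rwa [hkj]
  unfold Opp at hi hj ⊢
  -- In `D` the colors of axis `k` of `C` avoid the two axes already occupied, so both lie on the
  -- one that is left.
  have key : ∀ l t, k ≠ l → (D.symm (C (l, 1))).1 = (D.symm (C (l, -1))).1 →
      (D.symm (C (l, 1))).1 ≠ (D.symm (C (k, t))).1 := fun l t hl h =>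
    not_three_on_axis _ _ _ (by simp) (by simp [Ne.symm hl]) (by simp [Ne.symm hl]) h
  have hpq : (D.symm (C (i, 1))).1 ≠ (D.symm (C (j, 1))).1 :=
    not_three_on_axis _ (D.symm (C (i, -1))) _ (by simp) (by simp [hac]) (by simp [hac]) hi
  have h1 := key i 1 hki hi
  have h2 := key i (-1) hki hi
  have h3 := key j 1 hkj hj
  have h4 := key j (-1) hkj hj
  omega

/-! ### Representatives -/

/-- Colorings of the faces `(0, 1), (0, -1), (1, 1), …`, one for each mask. -/
def colorings : List (Fin 6 → Fin 6) := [
  ![0, 1, 2, 3, 4, 5], ![0, 1, 2, 3, 5, 4], ![0, 1, 2, 4, 3, 5], ![0, 1, 2, 4, 5, 3],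
  ![0, 1, 2, 5, 3, 4], ![0, 1, 2, 5, 4, 3], ![0, 2, 1, 3, 4, 5], ![0, 2, 1, 3, 5, 4],
  ![0, 2, 1, 4, 3, 5], ![0, 2, 1, 4, 5, 3], ![0, 2, 1, 5, 3, 4], ![0, 2, 1, 5, 4, 3],
  ![0, 3, 1, 2, 4, 5], ![0, 3, 1, 2, 5, 4], ![0, 3, 1, 4, 2, 5], ![0, 3, 1, 4, 5, 2],
  ![0, 3, 1, 5, 2, 4], ![0, 3, 1, 5, 4, 2], ![0, 4, 1, 2, 3, 5], ![0, 4, 1, 2, 5, 3],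
  ![0, 4, 1, 3, 2, 5], ![0, 4, 1, 3, 5, 2], ![0, 4, 1, 5, 2, 3], ![0, 4, 1, 5, 3, 2],
  ![0, 5, 1, 2, 3, 4], ![0, 5, 1, 2, 4, 3], ![0, 5, 1, 3, 2, 4], ![0, 5, 1, 3, 4, 2],
  ![0, 5, 1, 4, 2, 3], ![0, 5, 1, 4, 3, 2]]

theorem exists_coloring : ∀ m ∈ masks, ∃ c ∈ colorings,
    maskOf (c 0) (c 1) (c 2) (c 3) (c 4) (c 5) = m ∧ Function.Injective c := by
  decide +kernel

theorem exists_mask_eq {m : ℕ} (hm : m ∈ masks) : ∃ C, mask C = m := by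
  obtain ⟨c, -, rfl, hc⟩ := exists_coloring m hm
  exact ⟨stdCube.trans (Equiv.ofBijective c (Finite.injective_iff_bijective.1 hc)), rfl⟩

def vertex : Fin 8 → Fin 3 → ℤˣ := ![![1, 1, 1], ![1, 1, -1], ![1, -1, 1], ![1, -1, -1],
  ![-1, 1, 1], ![-1, 1, -1], ![-1, -1, 1], ![-1, -1, -1]]

theorem vertex_bijective : Function.Bijective vertex := by
  constructor
  · decide
  · intro s
    rw [signs_eq s]
    rcases Int.units_eq_one_or (s 0) with h0 | h0 <;> rcases Int.units_eq_one_or (s 1) with h1 | h1 <;>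
      rcases Int.units_eq_one_or (s 2) with h2 | h2 <;> rw [h0, h1, h2]
    exacts [⟨0, rfl⟩, ⟨1, rfl⟩, ⟨2, rfl⟩, ⟨3, rfl⟩, ⟨4, rfl⟩, ⟨5, rfl⟩, ⟨6, rfl⟩, ⟨7, rfl⟩]

/-- The codes of the corners of the standard cube, in the orders given by the 24 rotations. -/
def rotatedCodes : List (List ℕ) := [
  [16, 32, 27, 23, 62, 53, 58, 69], [23, 27, 32, 16, 69, 58, 53, 62],
  [53, 62, 69, 58, 32, 16, 23, 27], [58, 69, 62, 53, 27, 23, 16, 32],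
  [27, 16, 23, 32, 58, 62, 69, 53], [32, 23, 16, 27, 53, 69, 62, 58],
  [62, 58, 53, 69, 16, 27, 32, 23], [69, 53, 58, 62, 23, 32, 27, 16],
  [32, 16, 53, 62, 23, 27, 69, 58], [62, 53, 16, 32, 58, 69, 27, 23],
  [27, 23, 58, 69, 16, 32, 62, 53], [69, 58, 23, 27, 53, 62, 32, 16],
  [16, 62, 32, 53, 27, 58, 23, 69], [53, 32, 62, 16, 69, 23, 58, 27],
  [58, 27, 69, 23, 62, 16, 53, 32], [23, 69, 27, 58, 32, 53, 16, 62],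
  [16, 27, 62, 58, 32, 23, 53, 69], [58, 62, 27, 16, 69, 53, 23, 32],
  [23, 32, 69, 53, 27, 16, 58, 62], [53, 69, 32, 23, 62, 58, 16, 27],
  [62, 16, 58, 27, 53, 32, 69, 23], [27, 58, 16, 62, 23, 69, 32, 53],
  [32, 53, 23, 69, 16, 62, 27, 58], [69, 23, 53, 32, 58, 27, 62, 16]]

/-- The third sign is forced by the determinant. Tabulating the rotated corner codes reduces the
next check, over all nonempty corner sets, to comparing lists. -/
theorem exists_rotation_of_mem_rotatedCodes : ∀ r ∈ rotatedCodes, ∃ σ : Equiv.Perm (Fin 3),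
    ∃ x y : ℤˣ, r = (List.finRange 8).map fun v =>
      cornerCode stdCube (moveCorner σ ![x, y, Equiv.Perm.sign σ * x * y] (vertex v)) := by
  decide +kernel

theorem exists_rotated_cornerSet : ∀ b₀ b₁ b₂ b₃ b₄ b₅ b₆ b₇ : Bool,
    (b₀ || b₁ || b₂ || b₃ || b₄ || b₅ || b₆ || b₇) = true →
    ∃ p ∈ cornerSets, p.1 = b₀.toNat + b₁.toNat + b₂.toNat + b₃.toNat + b₄.toNat + b₅.toNat +
      b₆.toNat + b₇.toNat ∧ ∃ r ∈ rotatedCodes,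
        r.map (fun v => p.2.testBit v) = [b₀, b₁, b₂, b₃, b₄, b₅, b₆, b₇] := by
  decide +kernel

/-- Every set of corners can be rotated to one of the representatives. -/
theorem exists_cornerSet {T : Finset (Fin 3 → ℤˣ)} (hT : T.Nonempty) :
    ∃ σ ε, Equiv.Perm.sign σ * ∏ i, ε i = 1 ∧ ∃ p ∈ cornerSets, p.1 = T.card ∧
      ∀ C, meets p.2 (mask C) = true → ∃ s ∈ T, Sees C stdCube (moveCorner σ ε s) := by
  have hcard : T.card = ∑ v, (decide (vertex v ∈ T)).toNat := by
    have h1 : T.card = ∑ s, (decide (s ∈ T)).toNat := by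
      simp [Bool.toNat, Bool.cond_decide]
    rw [h1]
    exact ((Equiv.ofBijective vertex vertex_bijective).sum_comp fun s =>
      (decide (s ∈ T)).toNat).symm
  obtain ⟨p, hp, hp1, r, hr, hpr⟩ := exists_rotated_cornerSet (decide (vertex 0 ∈ T))
    (decide (vertex 1 ∈ T)) (decide (vertex 2 ∈ T)) (decide (vertex 3 ∈ T))
    (decide (vertex 4 ∈ T)) (decide (vertex 5 ∈ T)) (decide (vertex 6 ∈ T))
    (decide (vertex 7 ∈ T)) (by
      obtain ⟨s, hs⟩ := hT
      obtain ⟨v, rfl⟩ := vertex_bijective.2 s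
      simp only [Bool.or_eq_true, decide_eq_true_eq]
      fin_cases v <;> tauto)
  obtain ⟨σ, x, y, rfl⟩ := exists_rotation_of_mem_rotatedCodes r hr
  refine ⟨σ, ![x, y, Equiv.Perm.sign σ * x * y], ?_, p, hp, ?_, fun C hC => ?_⟩
  · rw [Fin.prod_univ_three]
    show Equiv.Perm.sign σ * (x * y * (Equiv.Perm.sign σ * x * y)) = 1
    rcases Int.units_eq_one_or (Equiv.Perm.sign σ) with h1 | h1 <;>
      rcases Int.units_eq_one_or x with rfl | rfl <;>
      rcases Int.units_eq_one_or y with rfl | rfl <;> rw [h1] <;> rfl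
  · rw [hp1, hcard]
    simp only [Fin.sum_univ_eight]
  · have hsub : ∀ p ∈ cornerSets, p.2 &&& stdMask = p.2 := by decide +kernel
    rw [meets, Bool.not_eq_true', land_beq_zero_eq_false] at hC
    obtain ⟨i, hi, hip⟩ := hC
    have hstd : stdMask.testBit i = true := by
      have := hip
      rw [← hsub p hp, Nat.testBit_and, Bool.and_eq_true] at this
      exact this.2
    rw [← mask_stdCube, testBit_mask] at hstd
    obtain ⟨s, rfl⟩ := hstd
    obtain ⟨s', rfl⟩ := exists_moveCorner_eq σ ![x, y, Equiv.Perm.sign σ * x * y] s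
    obtain ⟨v, rfl⟩ := vertex_bijective.2 s'
    refine ⟨vertex v, ?_, hi⟩
    have hv : p.2.testBit (cornerCode stdCube (moveCorner σ ![x, y, Equiv.Perm.sign σ * x * y]
        (vertex v))) = decide (vertex v ∈ T) := by
      have := congrArg (fun l : List Bool => l[(v : ℕ)]?) hpr
      fin_cases v <;> simpa [List.finRange] using this
    rw [hip] at hv
    exact of_decide_eq_true hv.symm

/-! ### Building the corners -/

/-- The number of cubes of the collection with a given mask. -/
def countMask {ι : Type*} [Fintype ι] (cubes : ι → ColoredCube) (k : ℕ) : ℕ :=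
  (Finset.univ.filter fun i => mask (cubes i) = k).card

/-- The collection satisfies Hall's condition for the corners of `M`. -/
def CornerHall {ι : Type*} [Fintype ι] (cubes : ι → ColoredCube) (M : ColoredCube) : Prop :=
  ∀ T : Finset (Fin 3 → ℤˣ),
    T.card ≤ (Finset.univ.filter fun i => ∃ s ∈ T, Sees (cubes i) M s).card

theorem masks_nodup : masks.Nodup := by decide +kernel

theorem sum_countMask {ι : Type*} [Fintype ι] (cubes : ι → ColoredCube) (p : ℕ → Bool) :
    (masks.map fun k => bif p k then countMask cubes k else 0).sum =
      (Finset.univ.filter fun i => p (mask (cubes i)) = true).card := by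
  rw [← List.sum_toFinset _ masks_nodup,
    Finset.card_eq_sum_card_fiberwise (f := fun i => mask (cubes i)) (t := masks.toFinset)
      fun i _ => by simpa using mask_mem_masks (cubes i)]
  refine Finset.sum_congr rfl fun k _ => ?_
  rw [Finset.filter_filter]
  cases hp : p k
  · rw [cond_false, eq_comm, Finset.card_eq_zero, Finset.filter_eq_empty_iff]
    rintro i - ⟨h1, h2⟩
    rw [h2, hp] at h1
    cases h1
  · rw [cond_true, countMask]
    congr 1
    ext i
    simp only [Finset.mem_filter, Finset.mem_univ, true_and]
    constructor
    · intro h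
      exact ⟨by rw [h, hp], h⟩
    · exact fun h => h.2

/-- A filling is a system of distinct representatives recorded only by type, so the necessity of
Hall's condition can be counted mask by mask. -/
theorem Fillable.cornerHall {ι : Type*} [Fintype ι] {cubes : ι → ColoredCube} {M : ColoredCube}
    (h : Fillable (countMask cubes) (mask M)) : CornerHall cubes M := by
  intro T
  obtain ⟨f, hf, hc⟩ := h
  set V := T.image (cornerCode M) with hV
  have hVb : V ⊆ bits (mask M) := by
    intro v hv
    obtain ⟨s, -, rfl⟩ := Finset.mem_image.1 hv
    exact mem_bits_mask.2 ⟨s, rfl⟩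
  calc T.card = V.card := (Finset.card_image_of_injective _ (cornerCode_injective M)).symm
    _ = ∑ k ∈ V.image f, (V.filter fun v => f v = k).card := Finset.card_eq_sum_card_image f V
    _ ≤ ∑ k ∈ V.image f, countMask cubes k := Finset.sum_le_sum fun k _ =>
        (Finset.card_le_card (Finset.filter_subset_filter _ hVb)).trans (hc k)
    _ = (Finset.univ.filter fun i => mask (cubes i) ∈ V.image f).card := by
        rw [Finset.card_eq_sum_card_fiberwise (f := fun i => mask (cubes i)) (t := V.image f)
          fun i hi => by simpa using hi]
        refine Finset.sum_congr rfl fun k hk => ?_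
        rw [countMask, Finset.filter_filter]
        congr 1
        ext i
        simp only [Finset.mem_filter, Finset.mem_univ, true_and]
        constructor
        · rintro rfl
          exact ⟨hk, rfl⟩
        · exact fun h => h.2
    _ ≤ _ := by
        refine Finset.card_le_card fun i hi => ?_
        rw [Finset.mem_filter] at hi ⊢
        obtain ⟨v, hv, hfv⟩ := Finset.mem_image.1 hi.2
        have hb := hf v (hVb hv)
        obtain ⟨s, hs, rfl⟩ := Finset.mem_image.1 hv
        refine ⟨hi.1, s, hs, ?_⟩
        rw [Sees, ← hfv]
        exact hb

theorem countMask_trans {ι : Type*} [Fintype ι] (cubes : ι → ColoredCube) (C : ColoredCube)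
    (π : Equiv.Perm (Fin 6)) :
    countMask (fun i => (cubes i).trans π) (mask (C.trans π)) = countMask cubes (mask C) := by
  simp only [countMask, mask_trans_eq_iff]

theorem cornerHall_trans_iff {ι : Type*} [Fintype ι] {cubes : ι → ColoredCube} {C : ColoredCube}
    (π : Equiv.Perm (Fin 6)) :
    CornerHall (fun i => (cubes i).trans π) (C.trans π) ↔ CornerHall cubes C := by
  simp only [CornerHall, sees_trans_iff]

/-- The corners of some colored cube can be built from any 32 colored cubes. -/
theorem exists_cornerHall {ι : Type*} [Fintype ι] (cubes : ι → ColoredCube)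
    (h : 32 ≤ Fintype.card ι) : ∃ M, CornerHall cubes M := by
  by_contra hcon
  push Not at hcon
  have : Nonempty ColoredCube := ⟨stdCube⟩
  obtain ⟨M, hM⟩ := Finite.exists_max fun C : ColoredCube => countMask cubes (mask C)
  have hbad := hcon M
  unfold CornerHall at hbad
  push Not at hbad
  obtain ⟨T, hT⟩ := hbad
  obtain ⟨σ, ε, hdet, p, hp, hpT, hmeets⟩ :=
    exists_cornerSet (Finset.card_pos.1 (Nat.zero_le _ |>.trans_lt hT))
  set g := signedPerm σ ε with hg
  set M' : ColoredCube := g.symm.trans M with hM'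
  have hgM : g.trans M' = M := by
    ext
    simp [hM']
  -- The rotation `g` carries the violating set `T` to a representative, and `π` renames colors so
  -- that the rotated model becomes `stdCube`. A fillable mask is then translated back to a cube
  -- satisfying Hall's condition.
  set π : Equiv.Perm (Fin 6) := M'.symm.trans stdCube with hπ
  have hstd : M'.trans π = stdCube := by
    ext
    simp [hπ]
  have hmaskM : mask M' = mask M := by
    rw [← hgM]
    exact (mask_signedPerm_trans hdet M').symm
  have hback : ∀ C : ColoredCube, (C.trans π.symm).trans π = C := by
    intro C
    ext
    simp
  have hsees : ∀ C s, Sees (C.trans π) stdCube (moveCorner σ ε s) → Sees C M s := by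
    intro C s hs
    rw [← hstd, sees_trans_iff] at hs
    have hcode := cornerCode_eq_iff.2 (sameCorner_moveCorner hdet M' s)
    rw [← hg, hgM] at hcode
    rw [Sees, hcode]
    exact hs
  obtain ⟨m, hm, hfill⟩ := exists_fillable (w := countMask fun i => (cubes i).trans π) (p := p) (by
      have := sum_countMask (fun i => (cubes i).trans π) fun _ => true
      simp only [cond_true, Finset.filter_true, Finset.card_univ] at this
      rw [← this] at h
      exact h) (by
      intro k hk
      obtain ⟨C, rfl⟩ := exists_mask_eq hk
      rw [← hback C, countMask_trans, ← mask_stdCube, ← hstd, countMask_trans, hmaskM]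
      exact hM _) hp (by
      rw [sum_countMask, hpT]
      refine lt_of_le_of_lt (Finset.card_le_card fun i hi => ?_) hT
      rw [Finset.mem_filter] at hi ⊢
      obtain ⟨s, hs, hs'⟩ := hmeets _ hi.2
      exact ⟨hi.1, s, hs, hsees _ s hs'⟩)
  obtain ⟨C, rfl⟩ := exists_mask_eq hm
  rw [← hback C] at hfill
  exact hcon _ ((cornerHall_trans_iff π).1 hfill.cornerHall)

/-! ### Positions of the frame -/

/-- The corners, and the inner positions of the edges; the edge `(k, u, v)` is parallel to the axis
`k` and lies on the faces `(k + 1, u)` and `(k + 2, v)`. -/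
abbrev Slot (N : ℕ) : Type := (Fin 3 → ℤˣ) ⊕ ((Fin 3 × ℤˣ × ℤˣ) × Fin N)

def extreme (N : ℕ) (u : ℤˣ) : Fin (N + 2) := if u = 1 then Fin.last _ else 0

def slotPos {N : ℕ} : Slot N → CubePos (N + 2)
  | .inl s => fun k => extreme N (s k)
  | .inr ((k, u, v), t) => fun j =>
    if j = k then t.succ.castSucc else if j = k + 1 then extreme N u else extreme N v

theorem onFace_iff {N : ℕ} {p : CubePos (N + 2)} {f : CubeFace} :
    OnFace p f ↔ p f.1 = extreme N f.2 := by
  have hne : (1 : ℤˣ) ≠ -1 := by decide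
  rw [OnFace, extreme, Fin.ext_iff]
  rcases Int.units_eq_one_or f.2 with h | h <;> simp [h, hne, hne.symm]

theorem extreme_injective (N : ℕ) : Function.Injective (extreme N) := by
  have hne : (-1 : ℤˣ) ≠ 1 := by decide
  intro u v h
  rcases Int.units_eq_one_or u with rfl | rfl <;> rcases Int.units_eq_one_or v with rfl | rfl <;>
    simp [extreme, hne, Fin.ext_iff] at h ⊢

theorem inner_ne_extreme {N : ℕ} (t : Fin N) (u : ℤˣ) : t.succ.castSucc ≠ extreme N u := by
  have := t.2
  rw [Ne, Fin.ext_iff, extreme]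
  split_ifs
  · simp
    omega
  · simp

theorem slotPos_corner_onFace_iff {N : ℕ} {s : Fin 3 → ℤˣ} {f : CubeFace} :
    OnFace (slotPos (N := N) (.inl s)) f ↔ f = (f.1, s f.1) := by
  rw [onFace_iff, slotPos, (extreme_injective N).eq_iff]
  constructor
  · intro h
    exact Prod.ext rfl h.symm
  · intro h
    exact (congrArg Prod.snd h).symm

theorem fin_three_cases (j k : Fin 3) : j = k ∨ j = k + 1 ∨ j = k + 2 := by
  omega

theorem slotPos_self {N : ℕ} (k : Fin 3) (u v : ℤˣ) (t : Fin N) :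
    slotPos (.inr ((k, u, v), t)) k = t.succ.castSucc := if_pos rfl

theorem slotPos_add_one {N : ℕ} (k : Fin 3) (u v : ℤˣ) (t : Fin N) :
    slotPos (.inr ((k, u, v), t)) (k + 1) = extreme N u :=
  (if_neg (by omega)).trans (if_pos rfl)

theorem slotPos_add_two {N : ℕ} (k : Fin 3) (u v : ℤˣ) (t : Fin N) :
    slotPos (.inr ((k, u, v), t)) (k + 2) = extreme N v :=
  (if_neg (by omega)).trans (if_neg (by omega))

theorem slotPos_edge_onFace_iff {N : ℕ} {k : Fin 3} {u v : ℤˣ} {t : Fin N} {f : CubeFace} :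
    OnFace (slotPos (.inr ((k, u, v), t))) f ↔ f = (k + 1, u) ∨ f = (k + 2, v) := by
  obtain ⟨j, w⟩ := f
  rw [onFace_iff]
  simp only [Prod.mk.injEq]
  rcases fin_three_cases j k with rfl | rfl | rfl
  · rw [slotPos_self]
    constructor
    · exact fun h => absurd h (inner_ne_extreme t w)
    · rintro (⟨h, -⟩ | ⟨h, -⟩) <;> omega
  · rw [slotPos_add_one, (extreme_injective N).eq_iff]
    constructor
    · rintro rfl
      exact Or.inl ⟨rfl, rfl⟩
    · rintro (⟨-, h⟩ | ⟨h, -⟩)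
      · exact h.symm
      · omega
  · rw [slotPos_add_two, (extreme_injective N).eq_iff]
    constructor
    · rintro rfl
      exact Or.inr ⟨rfl, rfl⟩
    · rintro (⟨h, -⟩ | ⟨-, h⟩)
      · omega
      · exact h.symm

theorem slotPos_mem_frame {N : ℕ} (x : Slot N) :
    ∃ f g : CubeFace, f ≠ g ∧ OnFace (slotPos x) f ∧ OnFace (slotPos x) g := by
  rcases x with s | ⟨⟨k, u, v⟩, t⟩
  · exact ⟨(0, s 0), (1, s 1), by simp, slotPos_corner_onFace_iff.2 rfl,
      slotPos_corner_onFace_iff.2 rfl⟩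
  · refine ⟨(k + 1, u), (k + 2, v), ?_, slotPos_edge_onFace_iff.2 (Or.inl rfl),
      slotPos_edge_onFace_iff.2 (Or.inr rfl)⟩
    rw [Ne, Prod.mk.injEq]
    omega

def slotFrame {N : ℕ} (x : Slot N) : FramePos (N + 2) := ⟨slotPos x, slotPos_mem_frame x⟩

theorem slotPos_injective {N : ℕ} : Function.Injective (slotPos (N := N)) := by
  rintro (s | ⟨⟨k, u, v⟩, t⟩) (s' | ⟨⟨k', u', v'⟩, t'⟩) h
  · congr 1
    funext j
    exact extreme_injective N (congrFun h j)
  · have := congrFun h k'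
    rw [slotPos_self] at this
    exact absurd this.symm (inner_ne_extreme t' _)
  · have := congrFun h k
    rw [slotPos_self] at this
    exact absurd this (inner_ne_extreme t _)
  · have hk := congrFun h k
    rw [slotPos_self] at hk
    rcases fin_three_cases k k' with rfl | rfl | rfl
    · rw [slotPos_self] at hk
      have h1 := congrFun h (k + 1)
      have h2 := congrFun h (k + 2)
      rw [slotPos_add_one, slotPos_add_one] at h1
      rw [slotPos_add_two, slotPos_add_two] at h2
      rw [extreme_injective N h1, extreme_injective N h2,
        Fin.succ_injective _ (Fin.castSucc_injective _ hk)]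
    · rw [slotPos_add_one] at hk
      exact absurd hk (inner_ne_extreme t _)
    · rw [slotPos_add_two] at hk
      exact absurd hk (inner_ne_extreme t _)

theorem slotFrame_bijective {N : ℕ} : Function.Bijective (slotFrame (N := N)) := by
  refine ⟨fun x y h => slotPos_injective (congrArg Subtype.val h), ?_⟩
  rintro ⟨p, f, g, hfg, hf, hg⟩
  rw [onFace_iff] at hf hg
  suffices ∃ x, slotPos x = p from this.imp fun x hx => Subtype.ext hx
  have haxis : f.1 ≠ g.1 := fun h =>
    hfg (Prod.ext h (extreme_injective N (by rw [← hf, ← hg, h])))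
  by_cases hall : ∀ j, ∃ u, p j = extreme N u
  · choose s hs using hall
    exact ⟨.inl s, funext fun j => (hs j).symm⟩
  · push Not at hall
    obtain ⟨k, hk⟩ := hall
    have hfk : f.1 ≠ k := fun h => hk f.2 (h ▸ hf)
    have hgk : g.1 ≠ k := fun h => hk g.2 (h ▸ hg)
    have hother : ∀ j, j ≠ k → ∃ u, p j = extreme N u := by
      intro j hj
      rcases (show j = f.1 ∨ j = g.1 by omega) with rfl | rfl
      · exact ⟨_, hf⟩
      · exact ⟨_, hg⟩
    obtain ⟨u, hu⟩ := hother (k + 1) (by omega)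
    obtain ⟨v, hv⟩ := hother (k + 2) (by omega)
    have h1 : (p k : ℕ) ≠ N + 1 := fun h => hk 1 (Fin.ext (by simpa [extreme] using h))
    have h0 : (p k : ℕ) ≠ 0 := fun h =>
      hk (-1) (Fin.ext (by simpa [extreme, show (-1 : ℤˣ) ≠ 1 by decide] using h))
    have hlt := (p k).2
    refine ⟨.inr ((k, u, v), ⟨p k - 1, by omega⟩), funext fun j => ?_⟩
    rcases fin_three_cases j k with rfl | rfl | rfl
    · rw [slotPos_self, Fin.ext_iff]
      simp
      omega
    · rw [slotPos_add_one, hu]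
    · rw [slotPos_add_two, hv]

theorem card_slot (N : ℕ) : Fintype.card (Slot N) = 12 * N + 8 := by
  rw [Fintype.card_sum, Fintype.card_prod, Fintype.card_fin,
    show Fintype.card (Fin 3 → ℤˣ) = 8 from rfl, show Fintype.card (Fin 3 × ℤˣ × ℤˣ) = 12 from rfl]
  ring

theorem card_framePos (N : ℕ) : Nat.card (FramePos (N + 2)) = 12 * N + 8 := by
  rw [← Nat.card_eq_of_bijective _ slotFrame_bijective, Nat.card_eq_fintype_card, card_slot]

/-! ### Building the frame -/

/-- The cube `C` can be placed into the slot. -/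
def Fits {N : ℕ} (C M : ColoredCube) : Slot N → Prop
  | .inl s => Sees C M s
  | .inr ((k, u, v), _) => ¬Opp C (M (k + 1, u)) (M (k + 2, v))

instance {N : ℕ} (C M : ColoredCube) : DecidablePred (Fits (N := N) C M)
  | .inl s => inferInstanceAs (Decidable (Sees C M s))
  | .inr ((k, u, v), _) => inferInstanceAs (Decidable (¬Opp C (M (k + 1, u)) (M (k + 2, v))))

theorem Fits.exists_rotation {N : ℕ} {C M : ColoredCube} {x : Slot N} (h : Fits C M x) :
    ∃ r, IsRotation r ∧ ∀ f, OnFace (slotPos x) f → C (r.symm f) = M f := by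
  rcases x with s | ⟨⟨k, u, v⟩, t⟩
  · obtain ⟨r, hr, hrs⟩ := Sees.exists_rotation h
    refine ⟨r, hr, fun f hf => ?_⟩
    rw [slotPos_corner_onFace_iff.1 hf]
    exact hrs f.1
  · obtain ⟨r, hr, h1, h2⟩ := exists_rotation_of_not_opp
      (show ((k + 1, u) : CubeFace).1 ≠ ((k + 2, v) : CubeFace).1 from
        fun h => by simp only at h; omega) h
    refine ⟨r, hr, fun f hf => ?_⟩
    rcases slotPos_edge_onFace_iff.1 hf with rfl | rfl
    · exact h1
    · exact h2

theorem canBuildFrame_of_injective {N : ℕ} {ι : Type*} {cubes : ι → ColoredCube} {M : ColoredCube}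
    {place : Slot N → ι} (hinj : Function.Injective place)
    (hfits : ∀ x, Fits (cubes (place x)) M x) : CanBuildFrame (N + 2) cubes := by
  choose rot hrot hface using fun x => (hfits x).exists_rotation
  set e := Equiv.ofBijective _ (slotFrame_bijective (N := N))
  refine ⟨M, place ∘ e.symm, rot ∘ e.symm, hinj.comp e.symm.injective, fun p => hrot _,
    fun p f hf => hface _ f ?_⟩
  have : slotFrame (e.symm p) = p := e.apply_symm_apply p
  rwa [show slotPos (e.symm p) = p.1 from congrArg Subtype.val this]

/-- The number of cubes with the same opposite pairs as `D`. -/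
def countClass {ι : Type*} [Fintype ι] (cubes : ι → ColoredCube) (D : ColoredCube) : ℕ :=
  (Finset.univ.filter fun i => mask (cubes i) = mask D ∨ mask (cubes i) = mask (mirror D)).card

/-- The number of cubes with `a` opposite to `b`. -/
def countOpp {ι : Type*} [Fintype ι] (cubes : ι → ColoredCube) (a b : Fin 6) : ℕ :=
  (Finset.univ.filter fun i => Opp (cubes i) a b).card

/-- Two edges of `M` with opposite colors in `C` have colors on different axes of `C`. -/
theorem edge_eq_of_opp {C M : ColoredCube} {e e' : Fin 3 × ℤˣ × ℤˣ}
    (h : Opp C (M (e.1 + 1, e.2.1)) (M (e.1 + 2, e.2.2)))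
    (h' : Opp C (M (e'.1 + 1, e'.2.1)) (M (e'.1 + 2, e'.2.2)))
    (hax : Opp C (M (e.1 + 1, e.2.1)) (M (e'.1 + 1, e'.2.1))) : e = e' := by
  obtain ⟨k, u, v⟩ := e
  obtain ⟨k', u', v'⟩ := e'
  simp only [Opp] at h h' hax
  have hinj : Function.Injective fun f => C.symm (M f) := C.symm.injective.comp M.injective
  have key : ∀ x y z : CubeFace, x ≠ y → (C.symm (M x)).1 = (C.symm (M y)).1 →
      (C.symm (M x)).1 = (C.symm (M z)).1 → z = x ∨ z = y := by
    intro x y z hxy h1 h2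
    by_contra hz
    push Not at hz
    exact not_three_on_axis _ _ _ (hinj.ne hxy) (hinj.ne hz.1.symm) (hinj.ne hz.2.symm) h1 h2
  have hne : ((k + 1, u) : CubeFace) ≠ (k + 2, v) := by
    rw [Ne, Prod.mk.injEq]
    omega
  have h1 := key _ _ _ hne h hax
  have h2 := key _ _ _ hne h (hax.trans h')
  simp only [Prod.mk.injEq] at h1 h2
  rcases h1 with ⟨ha, rfl⟩ | ⟨ha, rfl⟩
  · have hk : k' = k := by omega
    subst hk
    rcases h2 with ⟨hb, -⟩ | ⟨-, rfl⟩
    · omega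
    · rfl
  · rcases h2 with ⟨hb, -⟩ | ⟨hb, -⟩
    · omega
    · omega

/-- The constants leave no slack. A set using one edge has at most `N + 8 = 12N + 8 - 11N` slots;
one using two or three edges has at most `3N + 8 = 12N + 8 - 9N`. Sets of corners alone are covered
by `hcorner`. -/
theorem canBuildFrame_of_hall {N : ℕ} {ι : Type*} [Fintype ι] {cubes : ι → ColoredCube}
    (hι : Fintype.card ι = 12 * N + 8) {M : ColoredCube} (hcorner : CornerHall cubes M)
    (hopp : ∀ a b, ¬Opp M a b → countOpp cubes a b ≤ 11 * N)
    (hclass : ∀ D a b, Opp D a b → ¬Opp M a b → countClass cubes D ≤ 9 * N) :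
    CanBuildFrame (N + 2) cubes := by
  classical
  suffices hall : ∀ S : Finset (Slot N),
      S.card ≤ (S.biUnion fun x => Finset.univ.filter fun i => Fits (cubes i) M x).card by
    obtain ⟨place, hinj, hmem⟩ :=
      (Finset.all_card_le_biUnion_card_iff_exists_injective _).1 hall
    exact canBuildFrame_of_injective hinj fun x => (Finset.mem_filter.1 (hmem x)).2
  intro S
  set E : Finset (Fin 3 × ℤˣ × ℤˣ) := S.toRight.image Prod.fst with hE
  have hS : S.card ≤ S.toLeft.card + E.card * N := by
    rw [← Finset.card_toLeft_add_card_toRight]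
    have : S.toRight ⊆ E ×ˢ Finset.univ := by
      intro x hx
      exact Finset.mem_product.2 ⟨Finset.mem_image_of_mem _ hx, Finset.mem_univ _⟩
    have := Finset.card_le_card this
    rw [Finset.card_product, Finset.card_univ, Fintype.card_fin] at this
    omega
  have hleft : S.toLeft.card ≤ 8 := Finset.card_le_univ _
  set U := S.biUnion fun x => Finset.univ.filter fun i => Fits (cubes i) M x with hU
  have hcompl : U.card + Uᶜ.card = 12 * N + 8 := by rw [Finset.card_add_card_compl, hι]
  have hB : ∀ i ∈ Uᶜ, ∀ e ∈ E, Opp (cubes i) (M (e.1 + 1, e.2.1)) (M (e.1 + 2, e.2.2)) := by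
    intro i hi e he
    obtain ⟨⟨e, t⟩, hx, rfl⟩ := Finset.mem_image.1 he
    rw [Finset.mem_toRight] at hx
    by_contra hno
    refine Finset.mem_compl.1 hi (Finset.mem_biUnion.2 ⟨_, hx, Finset.mem_filter.2
      ⟨Finset.mem_univ _, hno⟩⟩)
  have hnotM : ∀ e : Fin 3 × ℤˣ × ℤˣ, ¬Opp M (M (e.1 + 1, e.2.1)) (M (e.1 + 2, e.2.2)) := by
    intro e
    simp only [Opp, Equiv.symm_apply_apply]
    omega
  rcases Finset.eq_empty_or_nonempty Uᶜ with hempty | ⟨i₀, hi₀⟩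
  · rw [hempty, Finset.card_empty] at hcompl
    have := Finset.card_le_univ S
    rw [card_slot] at this
    omega
  rcases Finset.eq_empty_or_nonempty E with hE0 | ⟨e, he⟩
  · refine le_trans (by rw [hE0, Finset.card_empty] at hS; omega) ((hcorner S.toLeft).trans
      (Finset.card_le_card fun i hi => ?_))
    obtain ⟨s, hs, hsee⟩ := (Finset.mem_filter.1 hi).2
    exact Finset.mem_biUnion.2 ⟨.inl s, Finset.mem_toLeft.1 hs,
      Finset.mem_filter.2 ⟨Finset.mem_univ _, hsee⟩⟩
  by_cases hE1 : E.card ≤ 1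
  · have hle : Uᶜ.card ≤ 11 * N := by
      refine le_trans (Finset.card_le_card fun i hi => ?_) (hopp _ _ (hnotM e))
      exact Finset.mem_filter.2 ⟨Finset.mem_univ _, hB i hi e he⟩
    have : E.card * N ≤ 1 * N := Nat.mul_le_mul_right _ hE1
    omega
  · obtain ⟨e', he', hne⟩ : ∃ e' ∈ E, e ≠ e' := by
      obtain ⟨a, ha, b, hb, hab⟩ := Finset.one_lt_card.1 (not_le.1 hE1)
      by_cases hea : e = a
      · exact ⟨b, hb, hea ▸ hab⟩
      · exact ⟨a, ha, hea⟩
    have hfaces : ∀ e : Fin 3 × ℤˣ × ℤˣ, M (e.1 + 1, e.2.1) ≠ M (e.1 + 2, e.2.2) := by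
      intro e h
      have := congrArg Prod.fst (M.injective h)
      simp only at this
      omega
    have hle : Uᶜ.card ≤ 9 * N := by
      refine le_trans (Finset.card_le_card fun i hi => ?_)
        (hclass (cubes i₀) _ _ (hB i₀ hi₀ e he) (hnotM e))
      refine Finset.mem_filter.2 ⟨Finset.mem_univ _, ?_⟩
      exact mask_eq_or_of_two_opp (hfaces e) (hfaces e')
        (fun h => hne (edge_eq_of_opp (hB i hi e he) (hB i hi e' he') h))
        (hB i hi e he) (hB i hi e' he') (hB i₀ hi₀ e he) (hB i₀ hi₀ e' he')
    -- Each edge in `E` uses up one axis of the excluded cube `i₀`, and different edges use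
    -- different axes.
    have hE3 : E.card ≤ 3 := by
      have : E.card ≤ (Finset.univ : Finset (Fin 3)).card :=
        Finset.card_le_card_of_injOn
          (fun e => ((cubes i₀).symm (M (e.1 + 1, e.2.1))).1) (fun _ _ => Finset.mem_univ _)
          fun a ha b hb hab => edge_eq_of_opp (hB i₀ hi₀ a ha) (hB i₀ hi₀ b hb) hab
      simpa using this
    have : E.card * N ≤ 3 * N := Nat.mul_le_mul_right _ hE3
    omega

/-! ### Collections in which two colors are often opposite -/

/-- The case `l = 0` is separate because `addEdge` treats every `l` other than 1 as at least two
cubes. -/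
def addMask (m q l : ℕ) (ts : List ℕ) : List ℕ :=
  bif Nat.beq l 0 then ts else addEdge (Nat.land m q) l ts [] []

theorem TreeInv.addMask {L : ℕ → ℕ} {m q : ℕ} {ts : List ℕ} (h : TreeInv L m ts) (l : ℕ)
    (hq : L q = 0) (hqm : q ≠ m) : TreeInv (Function.update L q l) m (addMask m q l ts) := by
  rcases Nat.eq_zero_or_pos l with rfl | hl
  · rw [← hq, Function.update_eq_self, hq]
    exact h
  · have hb : Nat.beq l 0 = false := by
      rw [← Bool.not_eq_true, Nat.beq_eq]
      omega
    rw [_root_.addMask, hb, cond_false]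
    exact h.addEdge hq hqm hl

/-- The cube `M` with the colors of two neighboring faces, both neighbors of the face `(k, 1)`,
interchanged. -/
def swapped (M : ColoredCube) (k : Fin 3) (t : ℤˣ) : ColoredCube :=
  (Equiv.swap (k + 1, -1) (k + 2, t)).trans M

theorem masks_swapped_ne (k : Fin 3) : List.Nodup [mask stdCube, mask (mirror stdCube),
    mask (swapped stdCube k 1), mask (mirror (swapped stdCube k 1)),
    mask (swapped stdCube k (-1)), mask (mirror (swapped stdCube k (-1)))] := by
  revert k
  decide +kernel

/-- The four masks meet the standard one in pairs of corners that partition all eight, so up to two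
cubes of each mask fill a new corner apiece. -/
theorem length_addMask_swapped : ∀ k l₁ l₂ l₃ l₄ : Fin 3,
    Nat.beq ((addMask (mask stdCube) (mask (mirror (swapped stdCube k (-1)))) l₄
      (addMask (mask stdCube) (mask (swapped stdCube k (-1))) l₃
        (addMask (mask stdCube) (mask (mirror (swapped stdCube k 1))) l₂
          (addMask (mask stdCube) (mask (swapped stdCube k 1)) l₁
            (singles (mask stdCube)))))).length + (l₁ + l₂ + l₃ + l₄)) 8 = true := by
  decide +kernel

theorem fillable_of_addMask {w : ℕ → ℕ} {m q₁ q₂ q₃ q₄ : ℕ} (hne : [m, q₁, q₂, q₃, q₄].Nodup)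
    (hlen : ∀ l₁ l₂ l₃ l₄ : Fin 3, Nat.beq ((addMask m q₄ l₄ (addMask m q₃ l₃
      (addMask m q₂ l₂ (addMask m q₁ l₁ (singles m))))).length + (l₁ + l₂ + l₃ + l₄)) 8 = true)
    (h : (2 - w q₁) + (2 - w q₂) + (2 - w q₃) + (2 - w q₄) ≤ w m) : Fillable w m := by
  simp only [List.nodup_cons, List.mem_cons, List.not_mem_nil, or_false, not_or] at hne
  obtain ⟨⟨h01, h02, h03, h04⟩, ⟨h12, h13, h14⟩, ⟨h23, h24⟩, h34, -⟩ := hne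
  have hmin : ∀ q, min (w q) 2 < 3 := fun q => by omega
  have hl := Nat.eq_of_beq_eq_true (hlen ⟨_, hmin q₁⟩ ⟨_, hmin q₂⟩ ⟨_, hmin q₃⟩ ⟨_, hmin q₄⟩)
  have ht := ((((treeInv_singles m).addMask (min (w q₁) 2) rfl (Ne.symm h01)).addMask
    (q := q₂) (min (w q₂) 2) (by simp [Ne.symm h12]) (Ne.symm h02)).addMask
    (q := q₃) (min (w q₃) 2) (by simp [Ne.symm h13, Ne.symm h23]) (Ne.symm h03)).addMask
    (q := q₄) (min (w q₄) 2) (by simp [Ne.symm h14, Ne.symm h24, Ne.symm h34]) (Ne.symm h04)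
  dsimp only at hl
  clear h01 h02 h03 h04 h12 h13 h14 h23 h24 h34
  refine ht.fillable (fun q => ?_) (by omega)
  simp only [Function.update_apply]
  split_ifs with h1 h2 h3 h4
  · exact h1 ▸ Nat.min_le_left _ _
  · exact h2 ▸ Nat.min_le_left _ _
  · exact h3 ▸ Nat.min_le_left _ _
  · exact h4 ▸ Nat.min_le_left _ _
  · exact Nat.zero_le _

theorem fillable_of_swapped {w : ℕ → ℕ} (k : Fin 3)
    (h : (2 - w (mask (swapped stdCube k 1))) + (2 - w (mask (mirror (swapped stdCube k 1)))) +
      (2 - w (mask (swapped stdCube k (-1)))) + (2 - w (mask (mirror (swapped stdCube k (-1))))) ≤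
        w (mask stdCube)) : Fillable w (mask stdCube) :=
  fillable_of_addMask ((masks_swapped_ne k).sublist (.cons_cons _ (.cons _ (.refl _))))
    (length_addMask_swapped k) h

theorem trans_symm_stdCube (M : ColoredCube) (g : Equiv.Perm CubeFace) :
    (g.trans M).trans (M.symm.trans stdCube) = g.trans stdCube := by
  ext
  simp

theorem mask_mirror_ne (M : ColoredCube) : mask M ≠ mask (mirror M) := by
  intro h
  rw [← mask_trans_eq_iff (M.symm.trans stdCube)] at h
  have := (List.nodup_cons.1 (masks_swapped_ne 0)).1
  rw [mirror, trans_symm_stdCube, show M.trans (M.symm.trans stdCube) = stdCube from trans_symm_stdCube M 1] at h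
  simp only [List.mem_cons, not_or] at this
  exact this.1 h

theorem cornerHall_of_swapped {ι : Type*} [Fintype ι] {cubes : ι → ColoredCube} {M : ColoredCube}
    (k : Fin 3)
    (h : (2 - countMask cubes (mask (swapped M k 1))) +
      (2 - countMask cubes (mask (mirror (swapped M k 1)))) +
      (2 - countMask cubes (mask (swapped M k (-1)))) +
      (2 - countMask cubes (mask (mirror (swapped M k (-1))))) ≤ countMask cubes (mask M)) :
    CornerHall cubes M := by
  set π := M.symm.trans stdCube with hπ
  have hM : M.trans π = stdCube := by
    ext
    simp [hπ]
  rw [← cornerHall_trans_iff π, hM]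
  have key : ∀ t, (swapped M k t).trans π = swapped stdCube k t :=
    fun t => trans_symm_stdCube M _
  have key' : ∀ t, (mirror (swapped M k t)).trans π = mirror (swapped stdCube k t) := fun t => by
    rw [mirror, mirror, ← key]
    rfl
  refine (fillable_of_swapped k ?_).cornerHall
  rw [← key', ← key', ← key, ← key, ← hM]
  simp only [countMask_trans]
  exact h

theorem mirror_mirror (C : ColoredCube) : mirror (mirror C) = C := by
  ext ⟨k, t⟩
  simp only [mirror, Equiv.trans_apply, signedPerm_apply, Equiv.Perm.one_apply, ← mul_assoc,
    Int.units_mul_self, one_mul]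

/-! ### Counting by classes and opposite pairs -/

section

variable {ι : Type*} [Fintype ι] (cubes : ι → ColoredCube)

theorem countClass_eq (D : ColoredCube) :
    countClass cubes D = countMask cubes (mask D) + countMask cubes (mask (mirror D)) := by
  classical
  rw [countClass, countMask, countMask, Finset.filter_or, Finset.card_union_of_disjoint]
  refine Finset.disjoint_filter.2 fun i _ h h' => mask_mirror_ne D (h.symm.trans h')

theorem countClass_mirror (D : ColoredCube) : countClass cubes (mirror D) = countClass cubes D := by
  rw [countClass_eq, countClass_eq, mirror_mirror, add_comm]

theorem opp_of_mem_class {C D : ColoredCube} {a b : Fin 6}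
    (h : mask C = mask D ∨ mask C = mask (mirror D)) (hD : Opp D a b) : Opp C a b := by
  rcases h with h | h
  · exact .of_mask_eq h hD
  · exact .of_mask_eq h (opp_mirror.2 hD)

theorem mem_class_symm {C D : ColoredCube} (h : mask C = mask D ∨ mask C = mask (mirror D)) :
    mask D = mask C ∨ mask D = mask (mirror C) := by
  refine mask_eq_or_of_opp fun k => opp_of_mem_class h ?_
  simp [Opp]

theorem countOpp_add_countClass_le {M : ColoredCube} {a b : Fin 6} (h : ¬Opp M a b) :
    countOpp cubes a b + countClass cubes M ≤ Fintype.card ι := by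
  classical
  rw [countOpp, countClass, ← Finset.card_union_of_disjoint]
  · exact Finset.card_le_univ _
  · exact Finset.disjoint_filter.2 fun i _ h1 h2 => h (opp_of_mem_class (mem_class_symm h2) h1)

theorem countClass_le_countOpp {D : ColoredCube} {a b : Fin 6} (h : Opp D a b) :
    countClass cubes D ≤ countOpp cubes a b :=
  Finset.card_le_card (Finset.monotone_filter_right _ fun _ _ h' => opp_of_mem_class h' h)

theorem cornerHall_of_eight_le {M : ColoredCube} (h : 8 ≤ countMask cubes (mask M)) :
    CornerHall cubes M := by
  intro T
  rcases T.eq_empty_or_nonempty with rfl | ⟨s, hs⟩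
  · simp
  refine ((Finset.card_le_univ T).trans (h.trans' (by decide))).trans ?_
  exact Finset.card_le_card (Finset.monotone_filter_right _ fun i _ hi =>
    ⟨s, hs, (mask_eq_iff.1 hi).1 s⟩)

/-- A coloring with `a` opposite to `b`, taken from the largest class of such colorings. -/
theorem exists_max_countClass {a b : Fin 6} (hab : a ≠ b) :
    ∃ M, Opp M a b ∧ (∀ D, Opp D a b → countClass cubes D ≤ countClass cubes M) ∧
      countMask cubes (mask (mirror M)) ≤ countMask cubes (mask M) := by
  classical
  have hne : (Finset.univ.filter fun D : ColoredCube => Opp D a b).Nonempty := by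
    refine ⟨stdCube.trans ((Equiv.swap (stdCube (0, -1)) (Equiv.swap (stdCube (0, 1)) a b)).trans
      (Equiv.swap (stdCube (0, 1)) a)), ?_⟩
    rw [Finset.mem_filter]
    refine ⟨Finset.mem_univ _, ?_⟩
    revert a b
    decide
  obtain ⟨M, hM, hmax⟩ := Finset.exists_max_image _ (countClass cubes) hne
  simp only [Finset.mem_filter, Finset.mem_univ, true_and] at hM hmax
  rcases le_total (countMask cubes (mask (mirror M))) (countMask cubes (mask M)) with h | h
  · exact ⟨M, hM, hmax, h⟩
  · refine ⟨mirror M, opp_mirror.2 hM, fun D hD => ?_, by rwa [mirror_mirror]⟩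
    rw [countClass_mirror]
    exact hmax D hD

theorem exists_partner (C : ColoredCube) (c : Fin 6) : ∃ d, d ≠ c ∧ Opp C c d := by
  refine ⟨C ((C.symm c).1, -(C.symm c).2), fun h => ?_, by simp [Opp]⟩
  have := congrArg (fun x => (C.symm x).2) h
  simp at this

/-- A coloring with the opposite pair of the axis `k` of `M` belongs to one of three classes. -/
theorem mem_class_of_opp {C M : ColoredCube} {k : Fin 3} (h : Opp C (M (k, 1)) (M (k, -1))) :
    (mask C = mask M ∨ mask C = mask (mirror M)) ∨
      ∃ t, mask C = mask (swapped M k t) ∨ mask C = mask (mirror (swapped M k t)) := by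
  obtain ⟨d, hd, hCd⟩ := exists_partner C (M (k + 1, 1))
  obtain ⟨⟨l, t⟩, rfl⟩ := M.surjective d
  have hinj : Function.Injective fun f => C.symm (M f) := C.symm.injective.comp M.injective
  have hC : ¬Opp C (M (k, 1)) (M (k + 1, 1)) :=
    not_three_on_axis _ _ _ (hinj.ne (by simp)) (hinj.ne (by simp)) (hinj.ne (by simp)) h
  have hab : M (k, 1) ≠ M (k, -1) := M.injective.ne (by simp)
  have hlk : l ≠ k := by
    rintro rfl
    apply hC
    rcases Int.units_eq_one_or t with rfl | rfl
    · exact hCd.symm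
    · exact h.trans hCd.symm
  rcases fin_three_cases l k with rfl | rfl | rfl
  · exact absurd rfl hlk
  · have ht : t = -1 := (Int.units_eq_one_or t).resolve_left (by rintro rfl; exact hd rfl)
    subst ht
    exact Or.inl (mask_eq_or_of_two_opp hab hd.symm hC h hCd (by simp [Opp]) (by simp [Opp]))
  · refine Or.inr ⟨t, mask_eq_or_of_two_opp hab hd.symm hC h hCd ?_ ?_⟩
    · have h1 : ∀ (k : Fin 3) t s, Equiv.swap ((k + 1, -1) : CubeFace) (k + 2, t) (k, s) = (k, s) := by
        decide
      simp [Opp, swapped, h1]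
    · have h1 : ∀ (k : Fin 3) (t : ℤˣ), Equiv.swap ((k + 1, -1) : CubeFace) (k + 2, t) (k + 1, 1) =
          (k + 1, 1) := by
        decide
      simp [Opp, swapped, h1]

theorem opp_swapped (M : ColoredCube) (k : Fin 3) (t : ℤˣ) :
    Opp (swapped M k t) (M (k, 1)) (M (k, -1)) := by
  have h1 : ∀ (k : Fin 3) t s, Equiv.swap ((k + 1, -1) : CubeFace) (k + 2, t) (k, s) = (k, s) := by
    decide
  simp [Opp, swapped, h1]

theorem countOpp_le_sum (M : ColoredCube) (k : Fin 3) :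
    countOpp cubes (M (k, 1)) (M (k, -1)) ≤ countClass cubes M +
      countClass cubes (swapped M k 1) + countClass cubes (swapped M k (-1)) := by
  classical
  simp only [countOpp, countClass]
  refine le_trans (Finset.card_le_card fun i hi => ?_)
    ((Finset.card_union_le _ _).trans (Nat.add_le_add_right (Finset.card_union_le _ _) _))
  simp only [Finset.mem_union, Finset.mem_filter, Finset.mem_univ, true_and] at hi ⊢
  rcases mem_class_of_opp hi with h | ⟨t, h⟩
  · exact Or.inl (Or.inl h)
  · rcases Int.units_eq_one_or t with rfl | rfl
    · exact Or.inl (Or.inr h)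
    · exact Or.inr h

/-- The 23 cubes lie in three classes, so the largest has at least 8 and its commoner mask at least
4. A class with two or more cubes leaves at most 2 of its 4 corners unfilled. If one of the other
classes has fewer than two cubes, the commoner mask has at least 6 cubes for at most 6 corners; if
both do, it has more than 8. -/
theorem cornerHall_of_countOpp {M : ColoredCube} (k : Fin 3)
    (h : 23 ≤ countOpp cubes (M (k, 1)) (M (k, -1)))
    (hmax : ∀ D, Opp D (M (k, 1)) (M (k, -1)) → countClass cubes D ≤ countClass cubes M)
    (hle : countMask cubes (mask (mirror M)) ≤ countMask cubes (mask M)) : CornerHall cubes M := by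
  apply cornerHall_of_swapped k
  have h0 := countOpp_le_sum cubes M k
  have h1 := hmax _ (opp_swapped M k 1)
  have h2 := hmax _ (opp_swapped M k (-1))
  simp only [countClass_eq] at h0 h1 h2
  omega

theorem countOpp_comm (a b : Fin 6) : countOpp cubes a b = countOpp cubes b a := by
  exact congrArg Finset.card (Finset.filter_congr fun _ _ => eq_comm)

/-- Cubes with two prescribed opposite pairs belong to one class. -/
theorem countOpp_le_of_two_opp {M : ColoredCube} {a b c d : Fin 6} (hab : a ≠ b)
    (hM : Opp M a b) (hcd : ¬Opp M c d)
    (hmax : ∀ D, Opp D a b → countClass cubes D ≤ countClass cubes M) :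
    countOpp cubes a b + countOpp cubes c d ≤ Fintype.card ι + countClass cubes M := by
  classical
  rw [countOpp, countOpp, ← Finset.card_union_add_card_inter]
  refine Nat.add_le_add (Finset.card_le_univ _) ?_
  rw [← Finset.filter_and]
  rcases Finset.eq_empty_or_nonempty
    (Finset.univ.filter fun i => Opp (cubes i) a b ∧ Opp (cubes i) c d) with h | ⟨i₀, h₀⟩
  · rw [h]
    exact Nat.zero_le _
  rw [Finset.mem_filter] at h₀
  refine le_trans (Finset.card_le_card (Finset.monotone_filter_right _ fun i _ hi => ?_))
    (hmax _ h₀.2.1)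
  have hne : c ≠ d := by
    rintro rfl
    exact hcd rfl
  refine mask_eq_or_of_two_opp hab hne (fun hac => hcd ?_) hi.1 hi.2 h₀.2.1 h₀.2.2
  have key : ∀ e, Opp (cubes i) a e → e = a ∨ e = b := by
    intro e he
    by_contra hcon
    push Not at hcon
    have hinj := (cubes i).symm.injective
    exact not_three_on_axis _ _ _ (hinj.ne hab) (hinj.ne hcon.1.symm) (hinj.ne hcon.2.symm) hi.1 he
  have hM' : ∀ e, e = a ∨ e = b → Opp M a e := by
    rintro e (rfl | rfl)
    · rfl
    · exact hM
  exact (hM' c (key c hac)).symm.trans (hM' d (key d (Eq.trans hac hi.2)))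

theorem canBuildFrame_of_card {N : ℕ} (hN : 2 ≤ N) (hι : Fintype.card ι = 12 * N + 8) :
    CanBuildFrame (N + 2) cubes := by
  by_cases hA : ∃ D, 9 * N + 1 ≤ countClass cubes D
  · obtain ⟨D, hD⟩ := hA
    obtain ⟨M, hM, h8⟩ : ∃ M, 9 * N + 1 ≤ countClass cubes M ∧ 8 ≤ countMask cubes (mask M) := by
      by_cases h : 8 ≤ countMask cubes (mask D)
      · exact ⟨D, hD, h⟩
      · refine ⟨mirror D, by rwa [countClass_mirror], ?_⟩
        rw [countClass_eq] at hD
        omega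
    refine canBuildFrame_of_hall hι (cornerHall_of_eight_le cubes h8) (fun a b h => ?_)
      fun D a b hD h => ?_
    -- At most `3N + 7` cubes lie outside the class of `M`, which is below both thresholds when `N ≥
    -- 2`.
    · have := countOpp_add_countClass_le cubes h
      omega
    · have := countOpp_add_countClass_le cubes h
      have := countClass_le_countOpp cubes hD
      omega
  push Not at hA
  have hclass : ∀ D, countClass cubes D ≤ 9 * N := fun D => Nat.le_of_lt_succ (hA D)
  by_cases hB : ∃ a b, a ≠ b ∧ 11 * N + 1 ≤ countOpp cubes a b
  · obtain ⟨a, b, hab, hcount⟩ := hB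
    obtain ⟨M, hM, hmax, hle⟩ := exists_max_countClass cubes hab
    refine canBuildFrame_of_hall hι (M := M) ?_ (fun c d hcd => ?_) fun D _ _ _ _ => hclass D
    · obtain ⟨⟨k, u⟩, rfl⟩ := M.surjective a
      obtain ⟨⟨l, v⟩, rfl⟩ := M.surjective b
      obtain rfl : k = l := by simpa [Opp] using hM
      have huv : u ≠ v := fun h => hab (by rw [h])
      rcases Int.units_eq_one_or u with rfl | rfl <;> rcases Int.units_eq_one_or v with rfl | rfl
      · exact absurd rfl huv
      · exact cornerHall_of_countOpp cubes k (by omega) hmax hle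
      · rw [countOpp_comm] at hcount
        exact cornerHall_of_countOpp cubes k (by omega) (fun D hD => hmax D hD.symm) hle
      · exact absurd rfl huv
    -- Adding the two bounds eliminates the size of the class of `M` and gives `2 * countOpp cubes c
    -- d ≤ 13N + 15 ≤ 22N`.
    · have := countOpp_add_countClass_le cubes hcd
      have := countOpp_le_of_two_opp cubes hab hM hcd hmax
      omega
  · push Not at hB
    -- The bound `N ≥ 2` gives `12N + 8 ≥ 32`.
    obtain ⟨M, hM⟩ := exists_cornerHall cubes (by omega)
    refine canBuildFrame_of_hall hι hM (fun a b h => ?_) fun D _ _ _ _ => hclass D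
    exact Nat.le_of_lt_succ (hB a b fun hab => h (by rw [hab]; rfl))

end

theorem theoremB (n : ℕ) (hn : 4 ≤ n) :
    Nat.card (FramePos n) = 12 * n - 16 ∧
      (∀ cubes : Fin (12 * n - 16) → ColoredCube, CanBuildFrame n cubes) ∧
      fr n = 12 * n - 16 := by
  obtain ⟨N, rfl⟩ : ∃ N, n = N + 2 := ⟨n - 2, by omega⟩
  have hcard : Nat.card (FramePos (N + 2)) = 12 * (N + 2) - 16 := by
    rw [card_framePos]
    omega
  have hbuild : ∀ cubes : Fin (12 * (N + 2) - 16) → ColoredCube, CanBuildFrame (N + 2) cubes :=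
    fun cubes => canBuildFrame_of_card cubes (by omega) (by rw [Fintype.card_fin]; omega)
  refine ⟨hcard, hbuild, le_antisymm (Nat.sInf_le hbuild) (le_csInf ⟨_, hbuild⟩ fun m hm => ?_)⟩
  -- For the lower bound any collection serves, as its members must fill all positions injectively.
  obtain ⟨-, place, -, hinj, -⟩ := hm fun _ => stdCube
  simpa [hcard] using Nat.card_le_card_of_injective place hinj
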